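/- **Conventions.** Let $\mathbb N^{\mathbb N}$ be Baire space, with pairing $\langle q,p\rangle=q(0)p(0)q(1)p(1)\dots$ and countable tupling $\langle p_0,p_1,\dots\rangle\langle i,k\rangle=p_i(k)$ for a standard computable bijection $\langle\cdot,\cdot\rangle:\mathbb N^2\to\mathbb N$. A partial function $F:\subseteq\mathbb N^{\mathbb N}\to\mathbb N^{\mathbb N}$ is *computable* if some machine with access to the input $p$ computes the sequence $F(p)$ for every $p\in\mathrm{dom}(F)$. It is *limit computable* if some machine with a two-way (revisable) output tape, upon any input $p\in\mathrm{dom}(F)$, produces an output in which every cell $n$ contains $F(p)(n)$ after finitely many steps and is not changed any more. It is *computable relative to* $q\in\mathbb N^{\mathbb N}$ if there is a computable $G$ with $F(p)=G\langle q,p\rangle$ for all $p\in\mathrm{dom}(F)$. Let $\lim:\subseteq\mathbb N^{\mathbb N}\to\mathbb N^{\mathbb N}$, $\langle p_0,p_1,\dots\rangle\mapsto\lim_i p_i$, be the limit map on (codes of) convergent sequences, and let $\mathsf J:\mathbb N^{\mathbb N}\to\mathbb N^{\mathbb N}$ be the Turing jump: $\mathsf J(p)(i)=1$ if the $i$-th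 machine halts upon input $p$, and $\mathsf J(p)(i)=0$ otherwise. The halting problem is $0'=\mathsf J(000\dots)$. The map $\mathsf J$ is injective. Put $\mathsf L=\mathsf J^{-1}\circ\lim$ (a partial function) and $\mathsf H=\mathsf J\circ\lim^{-1}$ (a multi-valued function, whose inverse $\mathsf H^{-1}=\lim\circ\,\mathsf J^{-1}$ is single-valued). A partial function $F$ is *low* if $F=\mathsf L\circ G$ for some computable partial $G$. A *represented space* is a set $X$ with a surjective partial map $\delta_X:\subseteq\mathbb N^{\mathbb N}\to X$ (a *representation* of $X$). A *problem* $f:\subseteq X\rightrightarrows Y$ is a partial multi-valued function between represented spaces. It is computable, limit computable, low, or computable relative to an oracle if there is a partial function $F$ on Baire space with that property which realizes $f$: whenever $\delta_X(p)\in\mathrm{dom}(f)$, then $\delta_Y(F(p))$ is defined and lies in $f(\delta_X(p))$. The spaces $X'$, $X^{\mathsf L}$, $X_{\mathsf J}$, $X_{\mathsf H}$ are the set $X$ with the representations $$\delta_X'=\delta_X\circ\lim,\qquad \delta_X^{\mathsf L}=\delta_X\circ\mathsf L,\qquad (\delta_X)_{\mathsf J}=\delta_X\circ\mathsf J^{-1},\qquad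 (\delta_X)_{\mathsf H}=\delta_X\circ\mathsf H^{-1}.$$ For represented spaces with $X\subseteq Y$, write $\delta_X\le\delta_Y$ if the inclusion $\mathrm{id}:X\to Y$ is computable. **Theorem.** Let $X,Y$ be represented spaces and let $f:\subseteq X\rightrightarrows Y$ be a problem. 1. The following are equivalent: (a) $f:\subseteq X\rightrightarrows Y$ is limit computable; (b) $f:\subseteq X\rightrightarrows Y'$ is computable; (c) $f:\subseteq X_{\mathsf J}\rightrightarrows Y$ is computable. 2. The following are equivalent: (a) $f:\subseteq X\rightrightarrows Y$ is low; (b) $f:\subseteq X\rightrightarrows Y^{\mathsf L}$ is computable; (c) $f:\subseteq X^{\mathsf L}\rightrightarrows Y^{\mathsf L}$ is computable; (d) $f:\subseteq X_{\mathsf J}\rightrightarrows Y_{\mathsf J}$ is computable; (e) $f:\subseteq X_{\mathsf J}\rightrightarrows Y_{\mathsf J}$ is computable relative to $0'$. 3. The following are equivalent: (a) $f:\subseteq X\rightrightarrows Y$ is computable relative to $0'$; (b) $f:\subseteq X_{\mathsf H}\rightrightarrows Y$ is computable; (c) $f:\subseteq X_{\mathsf H}\rightrightarrows Y_{\mathsf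 H}$ is computable; (d) $f:\subseteq X'\rightrightarrows Y'$ is computable; (e) $f:\subseteq X'\rightrightarrows Y'$ is low. 4. If $(A,\delta_A)$ and $(B,\delta_B)$ are represented spaces with $A\subseteq B$, then $(\delta_A)_{\mathsf J}\le\delta_B\iff\delta_A\le\delta_B'$. In particular, on the representations of a fixed set, preordered by $\le$, the pair $(\delta\mapsto\delta_{\mathsf J},\ \delta\mapsto\delta')$ is a Galois connection: both maps are monotone, and $\delta_{\mathsf J}\le\varepsilon\iff\delta\le\varepsilon'$ for all representations $\delta,\varepsilon$. -/

import Mathlib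

open Filter Topology

universe u v w

namespace RepSpaces

/-- Baire space. -/
abbrev Baire : Type := ℕ → ℕ

/-! ### Oracle programs

Programs with a free oracle symbol: Kleene's schemes, which are those of Mathlib's
`Nat.Partrec.Code`, together with one additional instruction `oracle` that queries the input
`p : Baire`. -/

/-- Programs that compute with access to an infinite input. -/
inductive Prog : Type
  | zero : Prog
  | succ : Prog
  | left : Prog
  | right : Prog
  | oracle : Prog
  | pair : Prog → Prog → Prog
  | comp : Prog → Prog → Prog
  | prec : Prog → Prog → Prog
  | rfind' : Prog → Prog

namespace Prog

/-- The partial function on the natural numbers computed by a program on input `p`. -/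
def eval (p : Baire) : Prog → ℕ → Part ℕ
  | zero, _ => Part.some 0
  | succ, n => Part.some (n + 1)
  | left, n => Part.some n.unpair.1
  | right, n => Part.some n.unpair.2
  | oracle, n => Part.some (p n)
  | pair cf cg, n => (eval p cf n).bind fun a => (eval p cg n).map (Nat.pair a)
  | comp cf cg, n => (eval p cg n).bind (eval p cf)
  | prec cf cg, n =>
    n.unpair.2.rec (eval p cf n.unpair.1) fun y IH =>
      IH.bind fun i => eval p cg (Nat.pair n.unpair.1 (Nat.pair y i))
  | rfind' cf, n =>
    (Nat.rfind fun k => (eval p cf (Nat.pair n.unpair.1 (k + n.unpair.2))).map (· = 0)).map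
      (· + n.unpair.2)

/-- The Gödel number of a program. -/
def encodeProg : Prog → ℕ
  | zero => 0
  | succ => 1
  | left => 2
  | right => 3
  | oracle => 4
  | pair cf cg => 2 * (2 * Nat.pair (encodeProg cf) (encodeProg cg)) + 5
  | comp cf cg => 2 * (2 * Nat.pair (encodeProg cf) (encodeProg cg) + 1) + 5
  | prec cf cg => (2 * (2 * Nat.pair (encodeProg cf) (encodeProg cg)) + 1) + 5
  | rfind' cf => (2 * (2 * encodeProg cf + 1) + 1) + 5

/-- The program with a given Gödel number. -/
def ofNatProg : ℕ → Prog
  | 0 => zero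
  | 1 => succ
  | 2 => left
  | 3 => right
  | 4 => oracle
  | n + 5 =>
    have hm : n.div2.div2 < n + 5 := by
      simp only [Nat.div2_val]
      exact
        lt_of_le_of_lt (le_trans (Nat.div_le_self _ _) (Nat.div_le_self _ _))
          (Nat.succ_le_succ (Nat.le_add_right _ _))
    have _m1 : n.div2.div2.unpair.1 < n + 5 := lt_of_le_of_lt (Nat.unpair_left_le _) hm
    have _m2 : n.div2.div2.unpair.2 < n + 5 := lt_of_le_of_lt (Nat.unpair_right_le _) hm
    match n.bodd, n.div2.bodd with
    | false, false => pair (ofNatProg n.div2.div2.unpair.1) (ofNatProg n.div2.div2.unpair.2)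
    | false, true => comp (ofNatProg n.div2.div2.unpair.1) (ofNatProg n.div2.div2.unpair.2)
    | true, false => prec (ofNatProg n.div2.div2.unpair.1) (ofNatProg n.div2.div2.unpair.2)
    | true, true => rfind' (ofNatProg n.div2.div2)

theorem ofNatProg_encodeProg (c : Prog) : ofNatProg (encodeProg c) = c := by
  induction c <;> simp [encodeProg, ofNatProg, Nat.div2_val, *]

/-- An ordinary program, regarded as a program that never queries its input. -/
def ofCode : Nat.Partrec.Code → Prog
  | .zero => zero
  | .succ => succ
  | .left => left
  | .right => right
  | .pair cf cg => pair (ofCode cf) (ofCode cg)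
  | .comp cf cg => comp (ofCode cf) (ofCode cg)
  | .prec cf cg => prec (ofCode cf) (ofCode cg)
  | .rfind' cf => rfind' (ofCode cf)

theorem eval_ofCode (p : Baire) (c : Nat.Partrec.Code) : eval p (ofCode c) = c.eval := by
  induction c with
  | zero | succ | left | right => rfl
  | pair _ _ hf hg =>
    funext n
    simp only [ofCode, eval, Nat.Partrec.Code.eval, hf, hg]
    simp [Seq.seq, Part.bind_map]
  | comp _ _ hf hg => funext n; simp only [ofCode, eval, Nat.Partrec.Code.eval, hf, hg]; rfl
  | prec _ _ hf hg => funext n; simp only [ofCode, eval, Nat.Partrec.Code.eval, hf, hg]; rfl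
  | rfind' _ hf => funext n; simp only [ofCode, eval, Nat.Partrec.Code.eval, hf]; rfl

/-- Replace every query to the input in the first program by a run of the second program. -/
def subst : Prog → Prog → Prog
  | zero, _ => zero
  | succ, _ => succ
  | left, _ => left
  | right, _ => right
  | oracle, d => d
  | pair cf cg, d => pair (subst cf d) (subst cg d)
  | comp cf cg, d => comp (subst cf d) (subst cg d)
  | prec cf cg, d => prec (subst cf d) (subst cg d)
  | rfind' cf, d => rfind' (subst cf d)

theorem eval_subst {p q : Baire} {d : Prog} (h : ∀ n, q n ∈ eval p d n) (c : Prog) :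
    eval p (subst c d) = eval q c := by
  induction c with
  | oracle => funext n; exact Part.eq_some_iff.2 (h n)
  | zero | succ | left | right => rfl
  | pair _ _ hf hg | comp _ _ hf hg | prec _ _ hf hg => funext n; simp only [subst, eval, hf, hg]
  | rfind' _ hf => funext n; simp only [subst, eval, hf]

/-- A program that outputs `n` on every argument. -/
def const : ℕ → Prog
  | 0 => zero
  | n + 1 => comp succ (const n)

theorem eval_const (p : Baire) (n m : ℕ) : eval p (const n) m = Part.some n := by
  induction n with
  | zero => rfl
  | succ n ih => simp [const, eval, ih]

end Prog

/-! ### Functions on Baire space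

Partial single-valued functions on Baire space have type `Baire → Part Baire`, and multi-valued
functions have type `Baire → Set Baire`, the domain being where the value is non-empty. -/

/-- A partial function on Baire space is computable if some program, on every input `p` in the
domain of `F`, computes the sequence `F p`. -/
def IsComputable (F : Baire → Part Baire) : Prop :=
  ∃ c : Prog, ∀ p, ∀ q ∈ F p, ∀ n, q n ∈ c.eval p n

/-- The pairing `⟨q, p⟩ = q(0) p(0) q(1) p(1) …` of two points of Baire space. -/
def interleave (q p : Baire) : Baire :=
  fun n => if n % 2 = 0 then q (n / 2) else p (n / 2)

/-- Computability relative to the oracle `q`. -/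
def IsComputableRel (q : Baire) (F : Baire → Part Baire) : Prop :=
  ∃ G : Baire → Part Baire, IsComputable G ∧ ∀ p, ∀ r ∈ F p, r ∈ G (interleave q p)

/-- The two-way output tape after `t` steps of a machine whose instruction in step `s` is `e s`:
the instruction `0` leaves the tape unchanged, and the instruction `Nat.pair m k + 1` overwrites
the cell `m` with the number `k`. All cells are blank (`none`) at the beginning. -/
def outputTape (e : ℕ → ℕ) : ℕ → ℕ → Option ℕ
  | 0, _ => none
  | t + 1, n =>
    if e t ≠ 0 ∧ (e t - 1).unpair.1 = n then some (e t - 1).unpair.2 else outputTape e t n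

/-- A partial function on Baire space is limit computable if there is a machine with a two-way
output tape (a program that on input `p` determines, for each step `t`, what the machine does to
its output tape in that step) such that for every input `p` in the domain of `F` the machine runs
forever and each output cell `n` is filled with `F(p)(n)` after finitely many steps and does not
change any more. -/
def IsLimitComputable (F : Baire → Part Baire) : Prop :=
  ∃ c : Prog, ∀ p, ∀ q ∈ F p, ∃ e : ℕ → ℕ, (∀ t, e t ∈ c.eval p t) ∧
    ∀ n, ∃ t₀, ∀ t ≥ t₀, outputTape e t n = some (q n)

/-- The `i`-th point `pᵢ` of the sequence coded by `p = ⟨p₀, p₁, p₂, …⟩`. -/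
def row (p : Baire) (i : ℕ) : Baire := fun k => p (Nat.pair i k)

/-- The limit map `⟨p₀, p₁, p₂, …⟩ ↦ lim pᵢ`, for the product topology on Baire space; its domain
consists of the codes of the convergent sequences. -/
noncomputable def limMap : Baire → Part Baire :=
  fun p => ⟨∃ q, Tendsto (row p) atTop (𝓝 q), fun h => h.choose⟩

open Classical in
/-- The Turing jump: `jump p i` is `1` if the `i`-th program halts upon input `p` (when started
with argument `0`), and `0` otherwise. -/
noncomputable def jump (p : Baire) : Baire :=
  fun i => if ((Prog.ofNatProg i).eval p 0).Dom then 1 else 0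

/-- The halting problem, which is the Turing jump of the constant zero sequence. -/
noncomputable def haltingProblem : Baire := jump fun _ => 0

/-- The inverse of a multi-valued function `S` for which this inverse is single-valued. -/
noncomputable def inverse (S : Baire → Set Baire) : Baire → Part Baire :=
  fun q => ⟨∃ p, q ∈ S p, fun h => h.choose⟩

/-- The Turing jump as a multi-valued function. -/
noncomputable def J : Baire → Set Baire := fun p => {jump p}

/-- The low map `J⁻¹ ∘ lim`. -/
noncomputable def L : Baire → Part Baire := fun p => (limMap p).bind (inverse J)

/-- The multi-valued function `J ∘ lim⁻¹`. -/
noncomputable def H : Baire → Set Baire := fun p => {r | ∃ q, p ∈ limMap q ∧ r = jump q}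

/-- A partial function on Baire space is low if it is `L ∘ G` for some computable `G`. -/
def IsLow (F : Baire → Part Baire) : Prop :=
  ∃ G : Baire → Part Baire, IsComputable G ∧ F = fun p => (G p).bind L

theorem mem_limMap {p q : Baire} : q ∈ limMap p ↔ Tendsto (row p) atTop (𝓝 q) :=
  ⟨fun ⟨h, e⟩ => e ▸ h.choose_spec,
    fun h => ⟨⟨q, h⟩, tendsto_nhds_unique (Exists.choose_spec (⟨q, h⟩ : ∃ q, Tendsto (row p) atTop (𝓝 q))) h⟩⟩

theorem mem_inverse {S : Baire → Set Baire} (hS : ∀ p p' q, q ∈ S p → q ∈ S p' → p = p')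
    {p q : Baire} : p ∈ inverse S q ↔ q ∈ S p :=
  ⟨fun ⟨h, e⟩ => e ▸ h.choose_spec,
    fun h => ⟨⟨p, h⟩, hS _ _ _ (Exists.choose_spec (⟨p, h⟩ : ∃ p, q ∈ S p)) h⟩⟩

theorem limMap_surjective (q : Baire) : ∃ p, q ∈ limMap p :=
  ⟨fun n => q n.unpair.2, mem_limMap.2 (by
    have : row (fun n => q n.unpair.2) = fun _ => q := by funext i k; simp [row]
    rw [this]; exact tendsto_const_nhds)⟩

theorem jump_injective : Function.Injective jump := by
  intro p q h
  funext n
  obtain ⟨c, hc⟩ := Nat.Partrec.Code.exists_code.1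
    (Nat.Partrec.rfind (Nat.Partrec.of_primrec
      (Primrec.nat_iff.1 (Primrec.ite
        (Primrec.eq.comp (Primrec.fst.comp Primrec.unpair) (Primrec.const (p n)))
        (Primrec.const 0) (Primrec.const 1)))))
  have hd : ∀ a, (c.eval a).Dom ↔ a = p n := by
    intro a
    rw [hc]
    refine Nat.rfind_dom.trans ⟨fun ⟨k, hk, _⟩ => ?_, fun ha => ⟨0, ?_, fun h => by omega⟩⟩
    · by_contra hne
      simp [PFun.coe_val, hne] at hk
    · simp [PFun.coe_val, ha]
  have key : ∀ r : Baire, ((Prog.eval r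
      (.comp (Prog.ofCode c) (.comp .oracle (Prog.const n))) 0).Dom ↔ r n = p n) := by
    intro r
    simp only [Prog.eval, Prog.eval_const, Prog.eval_ofCode, Part.bind_some]
    change ((Part.some (r n)).bind fun x => c.eval x).Dom ↔ _
    rw [Part.bind_some]
    exact hd (r n)
  have h1 := congrFun h (Prog.encodeProg (.comp (Prog.ofCode c) (.comp .oracle (Prog.const n))))
  simp only [jump, Prog.ofNatProg_encodeProg, key] at h1
  by_contra hne
  simp [Ne.symm hne] at h1

theorem J_inverse_unique : ∀ p p' q, q ∈ J p → q ∈ J p' → p = p' := by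
  rintro p p' q rfl h
  exact jump_injective h

theorem H_inverse_unique : ∀ p p' q, q ∈ H p → q ∈ H p' → p = p' := by
  rintro p p' q ⟨a, ha, rfl⟩ ⟨b, hb, h⟩
  cases jump_injective h
  exact Part.mem_unique ha hb

theorem L_surjective (p : Baire) : ∃ q, p ∈ L q := by
  obtain ⟨q, hq⟩ := limMap_surjective (jump p)
  exact ⟨q, Part.mem_bind hq ((mem_inverse J_inverse_unique).2 rfl)⟩

/-! ### Representations and represented spaces -/

/-- A representation of `X`: a surjective partial function from Baire space to `X`. -/
structure Representation (X : Type u) where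
  /-- The representation map. -/
  map : Baire → Part X
  surjective : ∀ x, ∃ p, x ∈ map p

namespace Representation

variable {X : Type u}

/-- The `T`-jump `δ ∘ T`. -/
def upper (δ : Representation X) (T : Baire → Part Baire) (hT : ∀ q, ∃ p, q ∈ T p) :
    Representation X where
  map p := (T p).bind δ.map
  surjective x := by
    obtain ⟨q, hq⟩ := δ.surjective x
    obtain ⟨p, hp⟩ := hT q
    exact ⟨p, Part.mem_bind hp hq⟩

/-- The `S⁻¹`-jump `δ ∘ S⁻¹`, for `S` whose inverse is single-valued and surjective. -/
noncomputable def lower (δ : Representation X) (S : Baire → Set Baire)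
    (hS : ∀ p p' q, q ∈ S p → q ∈ S p' → p = p') (hS' : ∀ p, (S p).Nonempty) :
    Representation X :=
  δ.upper (inverse S) fun p => (hS' p).imp fun _ hq => (mem_inverse hS).2 hq

/-- The jump `δ' = δ ∘ lim`. -/
noncomputable def limJump (δ : Representation X) : Representation X :=
  δ.upper limMap limMap_surjective

/-- The low jump `δ ∘ L`. -/
noncomputable def lowJump (δ : Representation X) : Representation X :=
  δ.upper L L_surjective

/-- The representation `δ_J = δ ∘ J⁻¹`. -/
noncomputable def subJ (δ : Representation X) : Representation X :=
  δ.lower J J_inverse_unique fun p => ⟨jump p, rfl⟩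

/-- The representation `δ_H = δ ∘ H⁻¹`. -/
noncomputable def subH (δ : Representation X) : Representation X :=
  δ.lower H H_inverse_unique fun p =>
    (limMap_surjective p).elim fun q hq => ⟨jump q, q, hq, rfl⟩

end Representation

/-! ### Problems

A problem from `X` to `Y`, that is a partial multi-valued function, is a map `f : X → Set Y`; its
domain is the set of all `x` with non-empty `f x`. -/

section

variable {X : Type u} {Y : Type v}

/-- `F` realizes the problem `f`: whenever `p` is a name of a point `x` in the domain of `f`, then
`F p` is defined and is a name of some point in `f x`. -/
def Realizes (δX : Representation X) (δY : Representation Y) (F : Baire → Part Baire)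
    (f : X → Set Y) : Prop :=
  ∀ p, ∀ x ∈ δX.map p, (f x).Nonempty → ∃ q ∈ F p, ∃ y ∈ δY.map q, y ∈ f x

/-- The problem `f` is computable. -/
def ComputableProblem (δX : Representation X) (δY : Representation Y) (f : X → Set Y) : Prop :=
  ∃ F, IsComputable F ∧ Realizes δX δY F f

/-- The problem `f` is computable relative to the oracle `q`. -/
def ComputableRelProblem (q : Baire) (δX : Representation X) (δY : Representation Y)
    (f : X → Set Y) : Prop :=
  ∃ F, IsComputableRel q F ∧ Realizes δX δY F f

/-- The problem `f` is limit computable. -/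
def LimitComputableProblem (δX : Representation X) (δY : Representation Y)
    (f : X → Set Y) : Prop :=
  ∃ F, IsLimitComputable F ∧ Realizes δX δY F f

/-- The problem `f` is low. -/
def LowProblem (δX : Representation X) (δY : Representation Y) (f : X → Set Y) : Prop :=
  ∃ F, IsLow F ∧ Realizes δX δY F f

end

/-- Reducibility of a representation of `A` to a representation of a superset `B`: the inclusion
of `A` into `B` is computable. -/
def Reducible {U : Type w} {A B : Set U} (hAB : A ⊆ B) (δA : Representation A)
    (δB : Representation B) : Prop :=
  ComputableProblem δA δB fun a => {Set.inclusion hAB a}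

/-- The preorder of reducibility on the representations of a fixed set `X`: `δ ≤ ε` means that the
identity is computable as a map from `(X, δ)` to `(X, ε)`. -/
instance {X : Type u} : Preorder (Representation X) where
  le δ ε := ComputableProblem δ ε fun x => {x}
  le_refl δ :=
    ⟨fun p => Part.some p, ⟨.oracle, fun p q hq n => by
      rw [Part.mem_some_iff.1 hq]; exact Part.mem_some _⟩,
      fun p x hx _ => ⟨p, Part.mem_some _, x, hx, rfl⟩⟩
  le_trans δ ε ζ := by
    rintro ⟨F, ⟨c, hc⟩, hF⟩ ⟨G, ⟨d, hd⟩, hG⟩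
    refine ⟨fun p => (F p).bind G, ⟨d.subst c, fun p r hr n => ?_⟩, fun p x hx hne => ?_⟩
    · obtain ⟨q, hq, hr⟩ := Part.mem_bind_iff.1 hr
      rw [Prog.eval_subst (hc p q hq)]
      exact hd q r hr n
    · obtain ⟨q, hq, y, hy, rfl⟩ := hF p x hx hne
      obtain ⟨r, hr, z, hz, hzy⟩ := hG q y hy ⟨y, rfl⟩
      exact ⟨r, Part.mem_bind hq hr, z, hz, hzy⟩

end RepSpaces

open RepSpaces

/-! Realizers enter only through their values on names. Index the names of the points in the domain
of `f` by a family `o i`. Then `f` is computable iff one program computes from every `o i` a name `g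
i` of a solution (`Names.computable_iff`). Passing to another representation replaces `o` or `g` by
jumps, or by sequences with prescribed limits, so every claim becomes a statement about
`UniformlyComputable` families.

Four uniform facts about limits and jumps carry the proof. The jump of `p` computes every limit of a
sequence computable from `p` (`of_limit`). Conversely, the jump is itself the limit of a computable
sequence (`exists_limit_jump`), and computable maps carry limits to limits of computable sequences
(`exists_limit`). Together these form a uniform limit lemma: being computable from `jump p` is the
same as being the limit of a sequence computable from `p`. This gives limit computability, the
Galois connection and, applied to jumps of solutions, the low case. The oracle `0'` is free there
because every jump computes it (`uniformlyComputable_haltingProblem`).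

Computability relative to `0'` needs the fourth fact, a low-limit construction (`exists_low_limit`):
every `p` is the limit of some `q` whose jump is computable from `0'` and `p`. Conversely the jump
of any sequence with limit `p` computes both `0'` and `p`. So, up to uniform computability,
supplying `jump q` for some `q` with limit `p` is the same as supplying `0'` together with `p`.

The low-limit construction is finite-extension forcing. At stage `n`, the halting problem decides
whether some admissible finite extension makes program `n` halt, while the first `n` columns are
frozen to the values of `p` from then on. Freezing forces convergence to `p`, and the decisions made
are the jump of `q`. -/

namespace RepSpaces

/-! ### Uniform computability relative to a family of oracles -/

section Uniform

variable {ι : Type*} {α β γ : Type*} [Primcodable α] [Primcodable β] [Primcodable γ]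

/-- A single program computes each of the functions `f i` from the oracle `o i`. -/
def UniformlyComputable (o : ι → Baire) (f : ι → α → β) : Prop :=
  ∃ c : Prog, ∀ i a, Encodable.encode (f i a) ∈ c.eval (o i) (Encodable.encode a)

namespace UniformlyComputable

variable {o g : ι → Baire}

theorem of_primrec (o : ι → Baire) {f : α → β} (hf : Primrec f) :
    UniformlyComputable o fun _ => f := by
  have h : Nat.Primrec fun n => (Encodable.encode ((Encodable.decode (α := α) n).map f)).pred :=
    Nat.Primrec.pred.comp hf
  obtain ⟨c, hc⟩ := Nat.Partrec.Code.exists_code.1 (Nat.Partrec.of_primrec h)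
  refine ⟨Prog.ofCode c, fun i a => ?_⟩
  rw [Prog.eval_ofCode, hc]
  simp

theorem comp {f : ι → β → γ} {h : ι → α → β} (hf : UniformlyComputable o f)
    (hh : UniformlyComputable o h) : UniformlyComputable o fun i a => f i (h i a) := by
  obtain ⟨c, hc⟩ := hf
  obtain ⟨d, hd⟩ := hh
  exact ⟨.comp c d, fun i a => Part.mem_bind (hd i a) (hc i _)⟩

theorem pair {f : ι → α → β} {h : ι → α → γ} (hf : UniformlyComputable o f)
    (hh : UniformlyComputable o h) : UniformlyComputable o fun i a => (f i a, h i a) := by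
  obtain ⟨c, hc⟩ := hf
  obtain ⟨d, hd⟩ := hh
  exact ⟨.pair c d, fun i a => Part.mem_bind (hc i a) (Part.mem_map _ (hd i a))⟩

theorem oracle (o : ι → Baire) : UniformlyComputable o o :=
  ⟨.oracle, fun _ _ => Part.mem_some _⟩

theorem primrec_comp {f : β → γ} (hf : Primrec f) {h : ι → α → β}
    (hh : UniformlyComputable o h) : UniformlyComputable o fun i a => f (h i a) :=
  (of_primrec o hf).comp hh

theorem comp_primrec {f : ι → β → γ} (hf : UniformlyComputable o f) {h : α → β}
    (hh : Primrec h) : UniformlyComputable o fun i a => f i (h a) :=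
  hf.comp (of_primrec o hh)

theorem trans {f : ι → α → β} (hf : UniformlyComputable g f) (hg : UniformlyComputable o g) :
    UniformlyComputable o f := by
  obtain ⟨c, hc⟩ := hf
  obtain ⟨d, hd⟩ := hg
  refine ⟨c.subst d, fun i a => ?_⟩
  rw [Prog.eval_subst (q := g i) (fun n => hd i n)]
  exact hc i a

theorem reindex {κ : Type*} {f : ι → α → β} (hf : UniformlyComputable o f) (r : κ → ι) :
    UniformlyComputable (o ∘ r) (f ∘ r) :=
  hf.imp fun _ hc k a => hc (r k) a

theorem nat_rec {f : ι → α → β} {h : ι → α × ℕ × β → β} (hf : UniformlyComputable o f)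
    (hh : UniformlyComputable o h) :
    UniformlyComputable o fun i (x : α × ℕ) =>
      (x.2.rec (f i x.1) fun n b => h i (x.1, n, b) : β) := by
  obtain ⟨c, hc⟩ := hf
  obtain ⟨d, hd⟩ := hh
  refine ⟨.prec c d, fun i ⟨a, n⟩ => ?_⟩
  simp only [Prog.eval, Encodable.encode_prod_val, Nat.unpair_pair, Encodable.encode_nat]
  induction n with
  | zero => exact hc i a
  | succ n ih => exact Part.mem_bind ih (hd i (a, n, _))

theorem list_map_range {f : ι → α × ℕ → β} {b : ι → α → ℕ} (hf : UniformlyComputable o f)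
    (hb : UniformlyComputable o b) :
    UniformlyComputable o fun i a => (List.range (b i a)).map fun m => f i (a, m) := by
  have h := nat_rec (o := o) (f := fun _ (_ : α) => ([] : List β))
    (h := fun i (x : α × ℕ × List β) => x.2.2 ++ [f i (x.1, x.2.1)])
    (of_primrec o (Primrec.const []))
    (primrec_comp (f := fun y : List β × β => y.1 ++ [y.2]) Primrec.list_concat
      (pair (of_primrec o (Primrec.snd.comp Primrec.snd))
        (hf.comp_primrec (Primrec.pair Primrec.fst (Primrec.fst.comp Primrec.snd)))))
  convert h.comp ((of_primrec o Primrec.id).pair hb) using 3 with i a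
  simp only [id]
  generalize b i a = n
  induction n with
  | zero => rfl
  | succ n ih => rw [List.range_succ, List.map_append, ih]; rfl

theorem exists_search_program {P : ι → α × ℕ → Bool} (hP : UniformlyComputable o P) :
    ∃ c : Prog, ∀ i a,
      (∀ n ∈ c.eval (o i) (Encodable.encode a), P i (a, n) = true) ∧
      ((c.eval (o i) (Encodable.encode a)).Dom ↔ ∃ n, P i (a, n) = true) := by
  obtain ⟨c, hc⟩ := primrec_comp (f := fun b : Bool => !b) Primrec.not hP
  -- `rfind'` searches for a zero, hence the negation in `c`. The pair of `left` and `right` is the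
  -- identity, and the appended `zero` is the starting point of the search.
  refine ⟨.comp (.rfind' c) (.pair (.pair .left .right) .zero), fun i a => ?_⟩
  have hev : ∀ k, c.eval (o i) (Nat.pair (Encodable.encode a) k) =
      Part.some (Encodable.encode (!P i (a, k))) := fun k => Part.eq_some_iff.2 (hc i (a, k))
  have key : (Prog.comp (.rfind' c) (.pair (.pair .left .right) .zero)).eval (o i)
      (Encodable.encode a) = Nat.rfind (PFun.lift fun k => P i (a, k)) := by
    simp only [Prog.eval, Part.map_some, Part.bind_some, Nat.pair_unpair, Nat.unpair_pair,
      Nat.add_zero, hev]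
    refine (Part.map_id' (fun x => rfl) _).trans (congrArg Nat.rfind (funext fun k => ?_))
    cases h : P i (a, k) <;> simp [h, PFun.coe_val]
  rw [key]
  refine ⟨fun n hn => (Part.mem_some_iff.1 (Nat.rfind_spec hn)).symm, ?_⟩
  exact ⟨fun ⟨n, hn, _⟩ => ⟨n, (Part.mem_some_iff.1 hn).symm⟩,
    fun ⟨n, hn⟩ => ⟨n, Part.mem_some_iff.2 hn.symm, fun _ _ => trivial⟩⟩

theorem search {P : ι → α × ℕ → Bool} (hP : UniformlyComputable o P)
    (hex : ∀ i a, ∃ n, P i (a, n) = true) :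
    ∃ h : ι → α → ℕ, UniformlyComputable o h ∧ ∀ i a, P i (a, h i a) = true := by
  obtain ⟨c, hc⟩ := exists_search_program hP
  have hd := fun i a => (hc i a).2.2 (hex i a)
  exact ⟨fun i a => (c.eval (o i) (Encodable.encode a)).get (hd i a),
    ⟨c, fun i a => Part.get_mem (hd i a)⟩, fun i a => (hc i a).1 _ (Part.get_mem (hd i a))⟩

theorem interleave_iff {q p : ι → Baire} :
    UniformlyComputable o (fun i => interleave (q i) (p i)) ↔
      UniformlyComputable o q ∧ UniformlyComputable o p := by
  refine ⟨fun h => ⟨?_, ?_⟩, fun ⟨hq, hp⟩ => ?_⟩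
  · convert h.comp_primrec (h := fun n => 2 * n)
      (Primrec.nat_mul.comp (Primrec.const 2) Primrec.id) using 3
    simp [interleave]
  · convert h.comp_primrec (h := fun n => 2 * n + 1)
      (Primrec.succ.comp (Primrec.nat_mul.comp (Primrec.const 2) Primrec.id)) using 3
    simp only [interleave]
    rw [if_neg (by omega)]
    congr 1
    omega
  · have hdiv : Primrec fun n : ℕ => n / 2 := Primrec.nat_div.comp Primrec.id (Primrec.const 2)
    exact primrec_comp (f := fun x : ℕ × ℕ × ℕ => if x.1 % 2 = 0 then x.2.1 else x.2.2)
      (Primrec.ite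
        (Primrec.eq.comp (Primrec.nat_mod.comp Primrec.fst (Primrec.const 2)) (Primrec.const 0))
        (Primrec.fst.comp Primrec.snd) (Primrec.snd.comp Primrec.snd))
      ((of_primrec o Primrec.id).pair
        ((hq.comp_primrec hdiv).pair (hp.comp_primrec hdiv)))

theorem left_of_interleave {q p : ι → Baire} :
    UniformlyComputable (fun i => interleave (q i) (p i)) q :=
  (interleave_iff.1 (oracle _)).1

theorem right_of_interleave {q p : ι → Baire} :
    UniformlyComputable (fun i => interleave (q i) (p i)) p :=
  (interleave_iff.1 (oracle _)).2

end UniformlyComputable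

/-! ### Existential questions answered by the jump -/

theorem jump_encodeProg (p : Baire) (c : Prog) :
    jump p c.encodeProg = 1 ↔ (c.eval p 0).Dom := by
  simp [jump, Prog.ofNatProg_encodeProg]

/-- The parameter theorem: hard-wiring an argument into a program is primitive recursive on Gödel
numbers. It is needed because `jump` runs programs only on the argument `0`. -/
theorem primrec_encodeProg_comp_const (c : Prog) :
    Primrec fun n => (Prog.comp c (Prog.const n)).encodeProg := by
  have hcomp : Primrec₂ fun a b : ℕ => 2 * (2 * Nat.pair a b + 1) + 5 := by
    refine Primrec.nat_add.comp (Primrec.nat_mul.comp (Primrec.const 2)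
      (Primrec.succ.comp (Primrec.nat_mul.comp (Primrec.const 2) ?_))) (Primrec.const 5)
    exact Primrec₂.natPair
  have hconst : Primrec fun n => (Prog.const n).encodeProg := by
    have h := Primrec.nat_rec₁ (f := fun _ IH => 2 * (2 * Nat.pair 1 IH + 1) + 5) 0
      (hcomp.comp₂ (Primrec₂.const 1) Primrec₂.right)
    refine h.of_eq fun n => ?_
    induction n with
    | zero => rfl
    | succ n ih => simp only [Prog.const, Prog.encodeProg, ← ih]
  exact hcomp.comp (Primrec.const c.encodeProg) hconst

-- An existential statement holds iff the unbounded search for a witness halts. With the parameter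
-- hard-wired, this is one query to the jump.
open Classical in
theorem UniformlyComputable.jump_decide {o : ι → Baire} {P : ι → α × ℕ → Bool}
    (hP : UniformlyComputable o P) :
    UniformlyComputable (fun i => jump (o i)) fun i a => decide (∃ n, P i (a, n) = true) := by
  obtain ⟨c, hc⟩ := exists_search_program hP
  have h := primrec_comp (f := fun n : ℕ => decide (n = 1))
    (Primrec.eq.comp Primrec.id (Primrec.const 1)).decide
    ((oracle fun i => jump (o i)).comp_primrec
      ((primrec_encodeProg_comp_const c).comp (Primrec.encode (α := α))))
  convert h using 3 with i a
  rw [decide_eq_decide, jump_encodeProg, ← (hc i a).2, Prog.eval, Prog.eval_const, Part.bind_some]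

end Uniform

/-! ### Evaluation with finitely much of the input -/

/-- The first `t` values of a point of Baire space. -/
def initSeg (p : Baire) (t : ℕ) : List ℕ := (List.range t).map p

theorem initSeg_getElem? (p : Baire) (t n : ℕ) :
    (initSeg p t)[n]? = if n < t then some (p n) else none := by
  split_ifs with h <;> simp [initSeg, h]

theorem initSeg_congr {p q : Baire} {t : ℕ} (h : ∀ n < t, p n = q n) :
    initSeg p t = initSeg q t :=
  List.map_congr_left fun n hn => h n (List.mem_range.1 hn)

open Nat.Partrec (Code)

/-- Divergence outside the list, instead of a default value, ensures that a result obtained from a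
finite prefix is correct for every infinite continuation. -/
theorem exists_lookup_code : ∃ c : Code, ∀ (l : List ℕ) (n v : ℕ),
    v ∈ c.eval (Nat.pair (Encodable.encode l) n) ↔ l[n]? = some v := by
  have hp : Primrec fun x : ℕ => (Denumerable.ofNat (List ℕ) x.unpair.1)[x.unpair.2]? :=
    Primrec.list_getElem?.comp
      ((Primrec.ofNat (List ℕ)).comp (Primrec.fst.comp Primrec.unpair))
      (Primrec.snd.comp Primrec.unpair)
  obtain ⟨c, hc⟩ := Code.exists_code.1 (Partrec.nat_iff.1 hp.to_comp.ofOption)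
  refine ⟨c, fun l n v => ?_⟩
  rw [hc]
  simp

/-- A code that looks up an entry of a coded list, and diverges if there is no such entry. -/
noncomputable def lookupCode : Code := exists_lookup_code.choose

/-- The code of a primitive recursive function. -/
theorem exists_primrec_code {f : ℕ → ℕ} (hf : Primrec f) :
    ∃ c : Code, ∀ n, c.eval n = Part.some (f n) := by
  obtain ⟨c, hc⟩ := Code.exists_code.1 (Nat.Partrec.of_primrec (Primrec.nat_iff.1 hf))
  exact ⟨c, fun n => by rw [hc]; rfl⟩

theorem code_eval_comp (cf cg : Code) (n : ℕ) :
    (Code.comp cf cg).eval n = (cg.eval n).bind fun a => cf.eval a := rfl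

theorem code_eval_pair (cf cg : Code) (n : ℕ) :
    (Code.pair cf cg).eval n = (cf.eval n).bind fun a => (cg.eval n).map (Nat.pair a) := by
  simp [Code.eval, Seq.seq, Part.bind_map]

theorem code_eval_prec (cf cg : Code) (n : ℕ) :
    (Code.prec cf cg).eval n = n.unpair.2.rec (cf.eval n.unpair.1) fun y IH =>
      IH.bind fun i => cg.eval (Nat.pair n.unpair.1 (Nat.pair y i)) := rfl

theorem code_eval_rfind' (cf : Code) (n : ℕ) :
    (Code.rfind' cf).eval n = (Nat.rfind fun k =>
      (cf.eval (Nat.pair n.unpair.1 (k + n.unpair.2))).map (· = 0)).map (· + n.unpair.2) := rfl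

theorem code_eval_succ (n : ℕ) : Code.succ.eval n = Part.some (n + 1) := rfl

theorem code_eval_left (n : ℕ) : Code.left.eval n = Part.some n.unpair.1 := rfl

theorem code_eval_right (n : ℕ) : Code.right.eval n = Part.some n.unpair.2 := rfl

/-- `Code.prec` and `Code.rfind'` keep only the first component of their argument fixed. The prefix
of the input must therefore be merged with the parameter before the recursion and separated again
inside it. -/
theorem primrec_reassoc_left :
    Primrec fun x : ℕ => Nat.pair (Nat.pair x.unpair.1 x.unpair.2.unpair.1) x.unpair.2.unpair.2 :=
  Primrec₂.natPair.comp
    (Primrec₂.natPair.comp (Primrec.fst.comp Primrec.unpair)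
      (Primrec.fst.comp (Primrec.unpair.comp (Primrec.snd.comp Primrec.unpair))))
    (Primrec.snd.comp (Primrec.unpair.comp (Primrec.snd.comp Primrec.unpair)))

theorem primrec_reassoc_right :
    Primrec fun x : ℕ => Nat.pair x.unpair.1.unpair.1 (Nat.pair x.unpair.1.unpair.2 x.unpair.2) :=
  Primrec₂.natPair.comp
    (Primrec.fst.comp (Primrec.unpair.comp (Primrec.fst.comp Primrec.unpair)))
    (Primrec₂.natPair.comp
      (Primrec.snd.comp (Primrec.unpair.comp (Primrec.fst.comp Primrec.unpair)))
      (Primrec.snd.comp Primrec.unpair))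

/-- A code of `⟨a, ⟨b, c⟩⟩ ↦ ⟨⟨a, b⟩, c⟩`. -/
noncomputable def assocLeftCode : Code := (exists_primrec_code primrec_reassoc_left).choose

/-- A code of `⟨⟨a, b⟩, c⟩ ↦ ⟨a, ⟨b, c⟩⟩`. -/
noncomputable def assocRightCode : Code := (exists_primrec_code primrec_reassoc_right).choose

theorem eval_assocLeftCode (a b : ℕ) : assocLeftCode.eval (Nat.pair a b) =
    Part.some (Nat.pair (Nat.pair a b.unpair.1) b.unpair.2) := by
  have h := (exists_primrec_code primrec_reassoc_left).choose_spec (Nat.pair a b)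
  simp only [Nat.unpair_pair] at h
  exact h

theorem eval_assocRightCode (a b c : ℕ) : assocRightCode.eval (Nat.pair (Nat.pair a b) c) =
    Part.some (Nat.pair a (Nat.pair b c)) := by
  have h := (exists_primrec_code primrec_reassoc_right).choose_spec (Nat.pair (Nat.pair a b) c)
  simp only [Nat.unpair_pair] at h
  exact h

/-! ### Simulation of oracle programs on finite prefixes -/

namespace Prog

/-- Translation of a program into a code that takes finitely much of the input as an additional
argument. -/
noncomputable def toCode : Prog → Code
  | zero => .zero
  | succ => .comp .succ .right
  | left => .comp .left .right
  | right => .comp .right .right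
  | oracle => lookupCode
  | pair cf cg => .pair (toCode cf) (toCode cg)
  | comp cf cg => .comp (toCode cf) (.pair .left (toCode cg))
  | prec cf cg => .comp (.prec (toCode cf) (.comp (toCode cg) assocRightCode)) assocLeftCode
  | rfind' cf => .comp (.rfind' (.comp (toCode cf) assocRightCode)) assocLeftCode

theorem eval_toCode_pair (cf cg : Prog) (l n : ℕ) :
    (toCode (pair cf cg)).eval (Nat.pair l n) = ((toCode cf).eval (Nat.pair l n)).bind fun a =>
      ((toCode cg).eval (Nat.pair l n)).map (Nat.pair a) := by
  simp only [toCode, code_eval_pair]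

theorem eval_toCode_comp (cf cg : Prog) (l n : ℕ) :
    (toCode (comp cf cg)).eval (Nat.pair l n) = ((toCode cg).eval (Nat.pair l n)).bind fun a =>
      (toCode cf).eval (Nat.pair l a) := by
  simp only [toCode, code_eval_comp, code_eval_pair, code_eval_left, Nat.unpair_pair,
    Part.bind_some, Part.bind_map]

theorem eval_toCode_prec (cf cg : Prog) (l n : ℕ) :
    (toCode (prec cf cg)).eval (Nat.pair l n) =
      n.unpair.2.rec ((toCode cf).eval (Nat.pair l n.unpair.1)) fun y IH =>
        IH.bind fun i => (toCode cg).eval (Nat.pair l (Nat.pair n.unpair.1 (Nat.pair y i))) := by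
  simp only [toCode, code_eval_comp, code_eval_prec, eval_assocLeftCode, eval_assocRightCode,
    Part.bind_some, Nat.unpair_pair]

theorem eval_toCode_rfind' (cf : Prog) (l n : ℕ) :
    (toCode (rfind' cf)).eval (Nat.pair l n) =
      (Nat.rfind fun k => ((toCode cf).eval
        (Nat.pair l (Nat.pair n.unpair.1 (k + n.unpair.2)))).map (· = 0)).map (· + n.unpair.2) := by
  simp only [toCode, code_eval_comp, code_eval_rfind', eval_assocLeftCode, eval_assocRightCode,
    Part.bind_some, Nat.unpair_pair]

/-- Queries beyond the prefix diverge, so a computation that returns a value has seen only true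
entries of `p`. -/
theorem eval_of_toCode {p : Baire} {t : ℕ} {c : Prog} {n v : ℕ}
    (h : v ∈ (toCode c).eval (Nat.pair (Encodable.encode (initSeg p t)) n)) : v ∈ eval p c n := by
  induction c generalizing n v with
  | zero => exact h
  | succ | left | right =>
    simpa only [toCode, code_eval_comp, code_eval_succ, code_eval_left, code_eval_right, eval,
      Part.bind_some, Nat.unpair_pair] using h
  | oracle =>
    have h := (exists_lookup_code.choose_spec _ _ _).1 h
    rw [initSeg_getElem?] at h
    split_ifs at h
    exact Part.mem_some_iff.2 (Option.some.inj h).symm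
  | pair cf cg hf hg =>
    rw [eval_toCode_pair] at h
    obtain ⟨a, ha, h⟩ := Part.mem_bind_iff.1 h
    obtain ⟨b, hb, rfl⟩ := (Part.mem_map_iff _).1 h
    exact Part.mem_bind (hf ha) (Part.mem_map _ (hg hb))
  | comp cf cg hf hg =>
    rw [eval_toCode_comp] at h
    obtain ⟨a, ha, h⟩ := Part.mem_bind_iff.1 h
    exact Part.mem_bind (hg ha) (hf h)
  | prec cf cg hf hg =>
    rw [eval_toCode_prec] at h
    rw [eval]
    generalize n.unpair.2 = m at h ⊢
    induction m generalizing v with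
    | zero => exact hf h
    | succ m ih =>
      obtain ⟨a, ha, h⟩ := Part.mem_bind_iff.1 h
      exact Part.mem_bind (ih ha) (hg h)
  | rfind' cf hf =>
    rw [eval_toCode_rfind'] at h
    obtain ⟨k, hk, rfl⟩ := (Part.mem_map_iff _).1 h
    have hk := Nat.mem_rfind.1 hk
    refine Part.mem_map _ (Nat.mem_rfind.2 ⟨?_, fun hm => ?_⟩)
    · obtain ⟨a, ha, h⟩ := (Part.mem_map_iff _).1 hk.1
      exact (Part.mem_map_iff _).2 ⟨a, hf ha, h⟩
    · obtain ⟨a, ha, h⟩ := (Part.mem_map_iff _).1 (hk.2 hm)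
      exact (Part.mem_map_iff _).2 ⟨a, hf ha, h⟩

/-- The use principle: a halting computation makes finitely many queries. Stating it for all large
`t` lets the subcomputations be combined at a common prefix length. -/
theorem eventually_toCode {p : Baire} {c : Prog} {n v : ℕ} (h : v ∈ eval p c n) :
    ∀ᶠ t in atTop, v ∈ (toCode c).eval (Nat.pair (Encodable.encode (initSeg p t)) n) := by
  induction c generalizing n v with
  | zero => exact Eventually.of_forall fun _ => h
  | succ | left | right =>
    exact Eventually.of_forall fun _ => by
      simpa only [toCode, code_eval_comp, code_eval_succ, code_eval_left, code_eval_right, eval,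
      Part.bind_some, Nat.unpair_pair] using h
  | oracle =>
    filter_upwards [eventually_gt_atTop n] with t ht
    refine (exists_lookup_code.choose_spec _ _ _).2 ?_
    rw [initSeg_getElem?, if_pos ht, Part.mem_some_iff.1 h]
  | pair cf cg hf hg =>
    obtain ⟨a, ha, h⟩ := Part.mem_bind_iff.1 h
    obtain ⟨b, hb, rfl⟩ := (Part.mem_map_iff _).1 h
    filter_upwards [hf ha, hg hb] with t hf hg
    rw [eval_toCode_pair]
    exact Part.mem_bind hf (Part.mem_map _ hg)
  | comp cf cg hf hg =>
    obtain ⟨a, ha, h⟩ := Part.mem_bind_iff.1 h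
    filter_upwards [hg ha, hf h] with t hg hf
    rw [eval_toCode_comp]
    exact Part.mem_bind hg hf
  | prec cf cg hf hg =>
    simp only [eval_toCode_prec]
    rw [eval] at h
    generalize n.unpair.2 = m at h ⊢
    induction m generalizing v with
    | zero => exact hf h
    | succ m ih =>
      obtain ⟨a, ha, h⟩ := Part.mem_bind_iff.1 h
      filter_upwards [ih ha, hg h] with t hf hg
      exact Part.mem_bind hf hg
  | rfind' cf hf =>
    simp only [eval_toCode_rfind']
    obtain ⟨k, hk, rfl⟩ := (Part.mem_map_iff _).1 h
    have hk := Nat.mem_rfind.1 hk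
    obtain ⟨a, ha, h0⟩ := (Part.mem_map_iff _).1 hk.1
    -- Only the finitely many tests before the least zero `k` have to converge at a common `t`.
    have hlt : ∀ᶠ t in atTop, ∀ m ∈ Set.Iio k, false ∈ ((toCode cf).eval
        (Nat.pair (Encodable.encode (initSeg p t))
          (Nat.pair n.unpair.1 (m + n.unpair.2)))).map fun x => decide (x = 0) := by
      refine (eventually_all_finite (Set.finite_Iio k)).2 fun m hm => ?_
      obtain ⟨b, hb, h⟩ := (Part.mem_map_iff _).1 (hk.2 hm)
      filter_upwards [hf hb] with t ht
      exact (Part.mem_map_iff _).2 ⟨b, ht, h⟩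
    filter_upwards [hf ha, hlt] with t h1 h2
    refine Part.mem_map _ (Nat.mem_rfind.2 ⟨(Part.mem_map_iff _).2 ⟨a, h1, h0⟩, fun hm => h2 _ hm⟩)

/-- Course-of-values recursion on the Gödel number: the components of a program have smaller
numbers. -/
theorem primrec_toCode_ofNatProg : Primrec fun n => toCode (ofNatProg n) := by
  -- `L` lists the translations of all smaller numbers, so its length is the number being
  -- translated. On such lists the default `.zero` is never used.
  let g : List Code → Option Code := fun L =>
    if L.length = 0 then some .zero
    else if L.length = 1 then some (.comp .succ .right)
    else if L.length = 2 then some (.comp .left .right)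
    else if L.length = 3 then some (.comp .right .right)
    else if L.length = 4 then some lookupCode
    else
      let m := L.length - 5
      let a := L[m.div2.div2.unpair.1]?.getD .zero
      let b := L[m.div2.div2.unpair.2]?.getD .zero
      some (bif m.bodd then
          (bif m.div2.bodd then
            .comp (.rfind' (.comp (L[m.div2.div2]?.getD .zero) assocRightCode)) assocLeftCode
          else .comp (.prec a (.comp b assocRightCode)) assocLeftCode)
        else (bif m.div2.bodd then .comp a (.pair .left b) else .pair a b))
  have hlen (k : ℕ) : PrimrecPred fun L : List Code => L.length = k :=
    Primrec.eq.comp Primrec.list_length (Primrec.const k)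
  have hm : Primrec fun L : List Code => L.length - 5 :=
    Primrec.nat_sub.comp Primrec.list_length (Primrec.const 5)
  have hget {f : List Code → ℕ} (hf : Primrec f) :
      Primrec fun L : List Code => L[f L]?.getD .zero :=
    Primrec.option_getD.comp (Primrec.list_getElem?.comp Primrec.id hf) (Primrec.const _)
  have hdd := Primrec.nat_div2.comp (Primrec.nat_div2.comp hm)
  have ha := hget (Primrec.fst.comp (Primrec.unpair.comp hdd))
  have hb := hget (Primrec.snd.comp (Primrec.unpair.comp hdd))
  have hbit := Primrec.nat_bodd.comp (Primrec.nat_div2.comp hm)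
  have hg : Primrec g := by
    refine Primrec.ite (hlen 0) (Primrec.const _) (Primrec.ite (hlen 1) (Primrec.const _)
      (Primrec.ite (hlen 2) (Primrec.const _) (Primrec.ite (hlen 3) (Primrec.const _)
      (Primrec.ite (hlen 4) (Primrec.const _) (Primrec.option_some.comp
        (Primrec.cond (Primrec.nat_bodd.comp hm) (Primrec.cond hbit ?_ ?_)
          (Primrec.cond hbit ?_ ?_)))))))
    · exact Code.primrec₂_comp.comp (Code.primrec_rfind'.comp
        (Code.primrec₂_comp.comp (hget hdd) (Primrec.const _))) (Primrec.const _)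
    · exact Code.primrec₂_comp.comp (Code.primrec₂_prec.comp ha
        (Code.primrec₂_comp.comp hb (Primrec.const _))) (Primrec.const _)
    · exact Code.primrec₂_comp.comp ha (Code.primrec₂_pair.comp (Primrec.const _) hb)
    · exact Code.primrec₂_pair.comp ha hb
  have hrec := Primrec.nat_strong_rec (fun (_ : Unit) n => toCode (ofNatProg n))
    (g := fun _ L => g L) (hg.comp₂ Primrec₂.right) fun _ n => by
      match n with
      | 0 | 1 | 2 | 3 | 4 => simp [g, ofNatProg, toCode]
      | n + 5 =>
        have h0 : n.div2.div2 < n + 5 := by simp only [Nat.div2_val]; omega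
        have h1 := (Nat.unpair_left_le n.div2.div2).trans_lt h0
        have h2 := (Nat.unpair_right_le n.div2.div2).trans_lt h0
        have e : ∀ k < n + 5,
            ((List.range (n + 5)).map fun n => toCode (ofNatProg n))[k]?.getD .zero =
              toCode (ofNatProg k) := fun k hk => by simp [hk]
        simp only [g, List.length_map, List.length_range, Nat.add_sub_cancel, e _ h0, e _ h1,
          e _ h2]
        rw [ofNatProg]
        cases n.bodd <;> cases n.div2.bodd <;> simp [toCode]
  exact hrec.comp (Primrec.const ()) Primrec.id

/-- Evaluation of the program with number `c` for `s` steps, on the argument `n` and with the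
finite part `l` of the input. -/
noncomputable def evalBounded (s c : ℕ) (l : List ℕ) (n : ℕ) : Option ℕ :=
  ((List.range (s + 1)).filterMap fun t =>
    Code.evaln s (toCode (ofNatProg c)) (Nat.pair (Encodable.encode (l.take t)) n)).head?

theorem primrec_evalBounded :
    Primrec fun x : ℕ × ℕ × List ℕ × ℕ => evalBounded x.1 x.2.1 x.2.2.1 x.2.2.2 := by
  refine Primrec.list_head?.comp (Primrec.listFilterMap
    (Primrec.list_range.comp (Primrec.succ.comp Primrec.fst)) ?_)
  refine Code.primrec_evaln.comp (Primrec.pair (Primrec.pair (Primrec.fst.comp Primrec.fst)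
    (primrec_toCode_ofNatProg.comp (Primrec.fst.comp (Primrec.snd.comp Primrec.fst))))
    (Primrec₂.natPair.comp (Primrec.encode.comp (Primrec.list_take.comp Primrec.snd
      (Primrec.fst.comp (Primrec.snd.comp (Primrec.snd.comp Primrec.fst)))))
      (Primrec.snd.comp (Primrec.snd.comp (Primrec.snd.comp Primrec.fst)))))

theorem take_initSeg (p : Baire) (t s : ℕ) : (initSeg p s).take t = initSeg p (min t s) := by
  simp [initSeg, ← List.map_take, List.take_range]

theorem eval_of_evalBounded {p : Baire} {s c t n v : ℕ}
    (h : evalBounded s c (initSeg p t) n = some v) : v ∈ eval p (ofNatProg c) n := by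
  obtain ⟨a, -, h⟩ := List.mem_filterMap.1 (List.mem_of_head? h)
  rw [take_initSeg] at h
  exact eval_of_toCode (Code.evaln_sound h)

/-- `Code.evaln s` rejects arguments exceeding `s`, and codes of long prefixes do. Since
`evalBounded` tries all prefixes up to length `s`, one fixed successful prefix remains available for
every larger `s`. Uniformity in `q` allows a point to be replaced by its approximations. -/
theorem exists_evalBounded {p : Baire} {c n v : ℕ} (h : v ∈ eval p (ofNatProg c) n) :
    ∃ s₀, ∀ s ≥ s₀, ∀ q : Baire, (∀ m < s₀, q m = p m) →
      evalBounded s c (initSeg q s) n = some v := by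
  obtain ⟨t, ht⟩ := (eventually_toCode h).exists
  obtain ⟨k, hk⟩ := Code.evaln_complete.1 ht
  refine ⟨max t k, fun s hs q hq => ?_⟩
  have hseg : initSeg q t = initSeg p t :=
    initSeg_congr fun m hm => hq m (hm.trans_le (le_max_left _ _))
  have hmem : v ∈ (List.range (s + 1)).filterMap fun t =>
      Code.evaln s (toCode (ofNatProg c))
        (Nat.pair (Encodable.encode ((initSeg q s).take t)) n) := by
    refine List.mem_filterMap.2 ⟨t, List.mem_range.2 (by omega), ?_⟩
    rw [take_initSeg, min_eq_left (by omega), hseg]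
    exact Code.evaln_mono (by omega) hk
  -- The first success may come from another prefix. By soundness it is still a value of the same
  -- computation on `q`, hence equal to `v`.
  obtain ⟨w, hw⟩ := Option.ne_none_iff_exists'.1
    (mt List.head?_eq_none_iff.1 (List.ne_nil_of_mem hmem))
  have hv : v ∈ eval q (ofNatProg c) n :=
    eval_of_toCode (t := t) (by rw [hseg]; exact ht)
  rw [Part.mem_unique hv (eval_of_evalBounded hw)]
  exact hw

end Prog

/-! ### Limits, jumps and the halting problem -/

theorem mem_limMap_iff {p q : Baire} :
    q ∈ limMap p ↔ ∀ k, ∃ s₀, ∀ s ≥ s₀, p (Nat.pair s k) = q k := by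
  simp only [mem_limMap, tendsto_pi_nhds, nhds_discrete, tendsto_pure, eventually_atTop]
  rfl

theorem jump_eq_encode {p : Baire} {n : ℕ} {b : Bool}
    (h : ((Prog.ofNatProg n).eval p 0).Dom ↔ b = true) : jump p n = Encodable.encode b := by
  cases b <;> simp_all [jump]

section Limits

variable {ι : Type*} {p q r : ι → Baire}

namespace UniformlyComputable

theorem initSeg_oracle (o : ι → Baire) : UniformlyComputable o fun i t => initSeg (o i) t :=
  list_map_range ((oracle o).comp_primrec (Primrec.snd (α := ℕ)))
    (of_primrec o (Primrec.id (α := ℕ)))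

theorem initSeg_row (o : ι → Baire) :
    UniformlyComputable o fun i s => initSeg (row (o i) s) s :=
  list_map_range ((oracle o).comp_primrec (Primrec₂.natPair.comp Primrec.fst Primrec.snd))
    (of_primrec o (Primrec.id (α := ℕ)))

/-- A computable image of a limit is the limit of a computable sequence. -/
theorem exists_limit (hq : UniformlyComputable q r) (hp : ∀ i, q i ∈ limMap (p i)) :
    ∃ g : ι → Baire, UniformlyComputable p g ∧ ∀ i, r i ∈ limMap (g i) := by
  obtain ⟨c, hc⟩ := hq
  have hseg := (initSeg_row p).comp_primrec (Primrec.fst.comp Primrec.unpair)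
  have hg := primrec_comp (o := p) (f := fun x : ℕ × List ℕ =>
      (Prog.evalBounded x.1.unpair.1 c.encodeProg x.2 x.1.unpair.2).getD 0)
    (Primrec.option_getD.comp (Prog.primrec_evalBounded.comp
      (Primrec.pair (Primrec.fst.comp (Primrec.unpair.comp Primrec.fst))
        (Primrec.pair (Primrec.const _) (Primrec.pair Primrec.snd
          (Primrec.snd.comp (Primrec.unpair.comp Primrec.fst)))))) (Primrec.const 0))
    ((of_primrec p Primrec.id).pair hseg)
  refine ⟨_, hg, fun i => mem_limMap_iff.2 fun k => ?_⟩
  have hk : r i k ∈ (Prog.ofNatProg c.encodeProg).eval (q i) k := by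
    rw [Prog.ofNatProg_encodeProg]
    exact hc i k
  obtain ⟨s₀, hs₀⟩ := Prog.exists_evalBounded hk
  have hlim := (mem_limMap_iff.1 (hp i))
  -- The computation depends only on the entries below `s₀`, and on these finitely many the rows
  -- eventually agree with the limit.
  have hev : ∀ᶠ s in atTop, ∀ m ∈ Set.Iio s₀, p i (Nat.pair s m) = q i m :=
    (eventually_all_finite (Set.finite_Iio s₀)).2 fun m _ => eventually_atTop.2 (hlim m)
  obtain ⟨s₁, hs₁⟩ := eventually_atTop.1 hev
  refine ⟨max s₀ s₁, fun s hs => ?_⟩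
  simp only [id, Nat.unpair_pair]
  rw [hs₀ s (le_of_max_le_left hs) (row (p i) s) (hs₁ s (le_of_max_le_right hs))]
  rfl

/-- The limit of a computable sequence is computable from the jump. -/
theorem of_limit (hp : UniformlyComputable p q) (hr : ∀ i, r i ∈ limMap (q i)) :
    UniformlyComputable (fun i => jump (p i)) r := by
  -- `x` consists of a cell `k`, a guess `⟨s, v⟩` and a number `n`. The test finds a row `s + n`
  -- refuting the guess that cell `k` equals `v` from row `s` on. The jump recognizes the guesses
  -- without refutation, so a correct one can be searched for.
  have hP : UniformlyComputable p fun i (x : (ℕ × ℕ) × ℕ) =>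
      !decide (q i (Nat.pair (x.1.2.unpair.1 + x.2) x.1.1) = x.1.2.unpair.2) :=
    primrec_comp (f := fun y : ℕ × ℕ => !decide (y.1 = y.2))
      (Primrec.not.comp (Primrec.eq.comp Primrec.fst Primrec.snd).decide)
      ((hp.comp_primrec (Primrec₂.natPair.comp (Primrec.nat_add.comp
        (Primrec.fst.comp (Primrec.unpair.comp (Primrec.snd.comp Primrec.fst))) Primrec.snd)
        (Primrec.fst.comp Primrec.fst))).pair
        (of_primrec p (Primrec.snd.comp (Primrec.unpair.comp (Primrec.snd.comp Primrec.fst)))))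
  obtain ⟨h, hh, hspec⟩ := search (primrec_comp Primrec.not hP.jump_decide) fun i k => by
    obtain ⟨s₀, hs₀⟩ := mem_limMap_iff.1 (hr i) k
    refine ⟨Nat.pair s₀ (r i k), ?_⟩
    simp only [Nat.unpair_pair, Bool.not_eq_true', decide_eq_false_iff_not, not_exists, not_not]
    exact fun n => hs₀ _ (Nat.le_add_right _ _)
  convert primrec_comp (Primrec.snd.comp Primrec.unpair) hh using 3 with i k
  have hs := hspec i k
  simp only [Bool.not_eq_true', decide_eq_false_iff_not, not_exists, not_not] at hs
  obtain ⟨s₀, hs₀⟩ := mem_limMap_iff.1 (hr i) k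
  rw [← hs s₀, hs₀ _ (Nat.le_add_left _ _)]

end UniformlyComputable

open UniformlyComputable

/-- The jump is the limit of a computable sequence. -/
theorem exists_limit_jump (p : ι → Baire) :
    ∃ g : ι → Baire, UniformlyComputable p g ∧ ∀ i, jump (p i) ∈ limMap (g i) := by
  -- Cell `k` of row `s` records whether program `k` is seen to halt at stage `s`. If the program
  -- halts, the entries are eventually `1`; otherwise soundness keeps them at `0`.
  have hg := primrec_comp (o := p) (f := fun x : ℕ × List ℕ =>
      if (Prog.evalBounded x.1.unpair.1 x.1.unpair.2 x.2 0).isSome = true then 1 else 0)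
    (Primrec.ite (Primrec.eq.comp (Primrec.option_isSome.comp (Prog.primrec_evalBounded.comp
      (Primrec.pair (Primrec.fst.comp (Primrec.unpair.comp Primrec.fst))
        (Primrec.pair (Primrec.snd.comp (Primrec.unpair.comp Primrec.fst))
          (Primrec.pair Primrec.snd (Primrec.const 0)))))) (Primrec.const true))
      (Primrec.const 1) (Primrec.const 0))
    ((of_primrec p Primrec.id).pair
      ((initSeg_oracle p).comp_primrec (Primrec.fst.comp Primrec.unpair)))
  refine ⟨_, hg, fun i => mem_limMap_iff.2 fun k => ?_⟩
  simp only [id, Nat.unpair_pair, jump]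
  by_cases hd : ((Prog.ofNatProg k).eval (p i) 0).Dom
  · obtain ⟨s₀, hs₀⟩ := Prog.exists_evalBounded (Part.get_mem hd)
    refine ⟨s₀, fun s hs => ?_⟩
    rw [hs₀ s hs _ fun _ _ => rfl, if_pos hd]
    rfl
  · refine ⟨0, fun s _ => ?_⟩
    rw [if_neg hd, if_neg]
    intro h
    obtain ⟨v, hv⟩ := Option.isSome_iff_exists.1 h
    exact hd (Part.dom_iff_mem.2 ⟨v, Prog.eval_of_evalBounded hv⟩)

theorem exists_limit_of_jump (hr : UniformlyComputable (fun i => jump (p i)) r) :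
    ∃ g : ι → Baire, UniformlyComputable p g ∧ ∀ i, r i ∈ limMap (g i) := by
  obtain ⟨g, hg, hlim⟩ := exists_limit_jump p
  obtain ⟨k, hk, hlim'⟩ := hr.exists_limit hlim
  exact ⟨k, hk.trans hg, hlim'⟩

/-- Halting on the zero input is an existential question that a program can pose while ignoring its
own oracle, so every jump answers it, uniformly. -/
theorem uniformlyComputable_haltingProblem (p : ι → Baire) :
    UniformlyComputable (fun i => jump (p i)) fun _ => haltingProblem := by
  classical
  have hseg := (initSeg_oracle fun _ : ι => (fun _ => 0 : Baire)).trans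
    (of_primrec p (Primrec.const 0))
  have hP := primrec_comp (f := fun y : (ℕ × ℕ) × List ℕ =>
      (Prog.evalBounded y.1.2 y.1.1 y.2 0).isSome)
    (Primrec.option_isSome.comp (Prog.primrec_evalBounded.comp
      (Primrec.pair (Primrec.snd.comp Primrec.fst) (Primrec.pair (Primrec.fst.comp Primrec.fst)
        (Primrec.pair Primrec.snd (Primrec.const 0))))))
    ((of_primrec p Primrec.id).pair (hseg.comp_primrec Primrec.snd))
  convert primrec_comp (f := fun b : Bool => Encodable.encode b) Primrec.encode
    hP.jump_decide using 3 with i k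
  have key : ((Prog.ofNatProg k).eval (fun _ => 0) 0).Dom ↔
      ∃ s, (Prog.evalBounded s k (initSeg (fun _ => 0) s) 0).isSome = true := by
    refine ⟨fun hd => ?_, fun ⟨s, hs⟩ => ?_⟩
    · obtain ⟨s₀, hs₀⟩ := Prog.exists_evalBounded (Part.get_mem hd)
      exact ⟨s₀, by rw [hs₀ s₀ le_rfl _ fun _ _ => rfl]; rfl⟩
    · obtain ⟨v, hv⟩ := Option.isSome_iff_exists.1 hs
      exact Part.dom_iff_mem.2 ⟨v, Prog.eval_of_evalBounded hv⟩
  exact jump_eq_encode (key.trans decide_eq_true_iff.symm)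

end Limits

/-! ### Names with low limits -/

/-- Extension of the finite sequence `σ` by the entries of `w`, where however the entries in the
columns below `π.length` are prescribed by `π`. -/
def extend (π σ w : List ℕ) : List ℕ :=
  σ ++ (List.range w.length).map fun m =>
    (π[(σ.length + m).unpair.2]?).getD (w[m]?.getD 0)

theorem length_extend (π σ w : List ℕ) : (extend π σ w).length = σ.length + w.length := by
  simp [extend]

theorem extend_getElem?_of_lt {π σ w : List ℕ} {m : ℕ} (h : m < σ.length) :
    (extend π σ w)[m]? = σ[m]? :=
  List.getElem?_append_left h

theorem extend_getElem?_add {π σ w : List ℕ} {m : ℕ} (h : m < w.length) :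
    (extend π σ w)[σ.length + m]? =
      some ((π[(σ.length + m).unpair.2]?).getD (w[m]?.getD 0)) := by
  rw [extend, List.getElem?_append_right (Nat.le_add_right _ _)]
  simp [h]

theorem primrec_extend :
    Primrec fun x : List ℕ × List ℕ × List ℕ => extend x.1 x.2.1 x.2.2 := by
  have hget {γ : Type} [Primcodable γ] {l : γ → List ℕ} {n d : γ → ℕ} (hl : Primrec l)
      (hn : Primrec n) (hd : Primrec d) : Primrec fun x => ((l x)[n x]?).getD (d x) :=
    Primrec.option_getD.comp (Primrec.list_getElem?.comp hl hn) hd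
  refine Primrec.list_append.comp (Primrec.fst.comp Primrec.snd) (Primrec.list_map
    (Primrec.list_range.comp (Primrec.list_length.comp (Primrec.snd.comp Primrec.snd))) ?_)
  exact hget (Primrec.fst.comp Primrec.fst)
    (Primrec.snd.comp (Primrec.unpair.comp (Primrec.nat_add.comp
      (Primrec.list_length.comp (Primrec.fst.comp (Primrec.snd.comp Primrec.fst))) Primrec.snd)))
    (hget (Primrec.snd.comp (Primrec.snd.comp Primrec.fst)) Primrec.snd (Primrec.const 0))

/-- A sequence of extensions that respects more and more columns converges to a point whose
columns are eventually the prescribed ones. -/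
theorem exists_generic {p : Baire} {σ w : ℕ → List ℕ}
    (hσ : ∀ n, σ (n + 1) = extend (initSeg p n) (σ n) (0 :: w n)) :
    ∃ q : Baire, p ∈ limMap q ∧ (∀ n, σ n = initSeg q (σ n).length) ∧
      ∀ n t, (σ n).length < t → ∃ u, initSeg q t = extend (initSeg p n) (σ n) (0 :: u) := by
  have hlen : ∀ n, (σ n).length < (σ (n + 1)).length := fun n => by
    rw [hσ, length_extend, List.length_cons]
    omega
  have hmono : StrictMono fun n => (σ n).length := strictMono_nat_of_lt_succ hlen
  have hle : ∀ n, n ≤ (σ n).length := fun _ => hmono.le_apply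
  have hpre : ∀ n m, n ≤ m → ∀ k < (σ n).length, (σ m)[k]? = (σ n)[k]? := by
    intro n m hnm k hk
    induction m, hnm using Nat.le_induction with
    | base => rfl
    | succ m hnm ih =>
      rw [hσ, extend_getElem?_of_lt (hk.trans_le (hmono.monotone hnm)), ih]
  -- Each stage adds at least one entry, the leading `0`, so `σ (n + 1)` is longer than `n` and the
  -- default is never used.
  let q : Baire := fun n => (σ (n + 1))[n]?.getD 0
  have hq : ∀ n, ∀ k < (σ n).length, (σ n)[k]? = some (q k) := by
    intro n k hk
    have hk' : k < (σ (k + 1)).length := hle (k + 1)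
    have e : (σ (k + 1))[k]? = some (q k) := by
      simp only [q, List.getElem?_eq_getElem hk', Option.getD_some]
    rcases le_total n (k + 1) with h | h
    · rw [← hpre _ _ h k hk, e]
    · rw [hpre _ _ h k hk', e]
  have hnew : ∀ n, ∀ k < (0 :: w n).length, q ((σ n).length + k) =
      ((initSeg p n)[((σ n).length + k).unpair.2]?).getD ((0 :: w n)[k]?.getD 0) := by
    intro n k hk
    have h := hq (n + 1) ((σ n).length + k) (by rw [hσ, length_extend]; omega)
    rw [hσ, extend_getElem?_add hk] at h
    exact (Option.some.inj h).symm
  -- From stage `n` on, all columns below `n` are frozen: a later stage prescribes a longer part of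
  -- `p`.
  have hcol : ∀ n m, (σ n).length ≤ m → m.unpair.2 < n → q m = p m.unpair.2 := by
    intro n m hnm hm
    have aux : ∀ k, n ≤ k → m < (σ k).length → q m = p m.unpair.2 := by
      intro k hk
      induction k, hk using Nat.le_induction with
      | base => exact fun h => absurd h (by omega)
      | succ k hnk ih =>
        intro h
        rcases lt_or_ge m (σ k).length with h' | h'
        · exact ih h'
        · obtain ⟨j, rfl⟩ := Nat.exists_eq_add_of_le h'
          rw [hσ, length_extend] at h
          rw [hnew k j (by omega), initSeg_getElem?, if_pos (hm.trans_le hnk)]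
          rfl
    exact aux (max n (m + 1)) (le_max_left _ _)
      (lt_of_lt_of_le (Nat.lt_of_succ_le (le_max_right n (m + 1))) (hle _))
  -- Column `k` is constant beyond the length of `σ (k + 1)`, which gives the limit. For the last
  -- claim, `u` is the part of `q` strictly after the position of the leading `0`.
  refine ⟨q, mem_limMap_iff.2 fun k => ⟨(σ (k + 1)).length, fun s hs => ?_⟩, fun n => ?_,
    fun n t ht => ⟨(List.range (t - ((σ n).length + 1))).map fun j => q ((σ n).length + 1 + j), ?_⟩⟩
  · rw [hcol (k + 1) _ (hs.trans (Nat.left_le_pair _ _)) (by rw [Nat.unpair_pair]; omega),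
      Nat.unpair_pair]
  · refine List.ext_getElem? fun k => ?_
    rw [initSeg_getElem?]
    split_ifs with hk
    · exact hq n k hk
    · exact List.getElem?_eq_none (not_lt.1 hk)
  · refine List.ext_getElem? fun m => ?_
    rw [initSeg_getElem?]
    rcases lt_or_ge m (σ n).length with hm | hm
    · rw [extend_getElem?_of_lt hm, hq n m hm, if_pos (hm.trans ht)]
    · obtain ⟨j, rfl⟩ := Nat.exists_eq_add_of_le hm
      rcases lt_or_ge ((σ n).length + j) t with hj | hj
      · rw [if_pos hj, extend_getElem?_add (by simp; omega), Option.some_inj, initSeg_getElem?]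
        split_ifs with hc
        · exact hcol n _ hm hc
        -- In an unfrozen column, the first new entry of `q` is the `0` put in front of `w n`, which
        -- agrees with the `0` put in front of `u`.
        · cases j with
          | zero =>
            rw [hnew n 0 (by simp), initSeg_getElem?, if_neg hc]
            simp
          | succ j =>
            rw [List.getElem?_cons_succ, List.getElem?_map,
              List.getElem?_range (by omega)]
            simp only [Option.map_some, Option.getD_some]
            congr 1
            omega
      · rw [if_neg (by omega), List.getElem?_eq_none]
        rw [length_extend]
        simp
        omega

/-- Every point is a limit whose jump is computable relative to the halting problem. -/
theorem exists_low_limit {ι : Type*} (p : ι → Baire) :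
    ∃ q : ι → Baire, (∀ i, p i ∈ limMap (q i)) ∧
      UniformlyComputable (fun i => interleave haltingProblem (p i)) fun i => jump (q i) := by
  classical
  let o : ι → Baire := fun i => interleave haltingProblem (p i)
  -- The first component is a program number with the current sequence and the prescribed column
  -- values. The second codes a candidate extension with a step bound, and the test is whether the
  -- program halts on it.
  let hit : (ℕ × List ℕ × List ℕ) × ℕ → Bool := fun x =>
    (Prog.evalBounded (Denumerable.ofNat (List ℕ × ℕ) x.2).2 x.1.1
      (extend x.1.2.2 x.1.2.1 (0 :: (Denumerable.ofNat (List ℕ × ℕ) x.2).1)) 0).isSome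
  have hof : Primrec fun x : (ℕ × List ℕ × List ℕ) × ℕ => Denumerable.ofNat (List ℕ × ℕ) x.2 :=
    (Primrec.ofNat _).comp Primrec.snd
  have hext : Primrec fun x : (ℕ × List ℕ × List ℕ) × ℕ =>
      extend x.1.2.2 x.1.2.1 (0 :: (Denumerable.ofNat (List ℕ × ℕ) x.2).1) :=
    primrec_extend.comp (Primrec.pair (Primrec.snd.comp (Primrec.snd.comp Primrec.fst))
      (Primrec.pair (Primrec.fst.comp (Primrec.snd.comp Primrec.fst))
        (Primrec.list_cons.comp (Primrec.const 0) (Primrec.fst.comp hof))))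
  have hhit : Primrec hit := Primrec.option_isSome.comp (Prog.primrec_evalBounded.comp
    (Primrec.pair (Primrec.snd.comp hof) (Primrec.pair (Primrec.fst.comp Primrec.fst)
      (Primrec.pair hext (Primrec.const 0)))))
  -- The question concerns finite data only, so the halting problem itself answers it, not just a
  -- jump of `p i`.
  have hdec : UniformlyComputable o fun _ a => decide (∃ x, hit (a, x) = true) :=
    (UniformlyComputable.of_primrec (fun _ : ι => (fun _ => 0 : Baire)) hhit).jump_decide.trans
      UniformlyComputable.left_of_interleave
  -- The first disjunct makes the search total: if no extension succeeds, every candidate is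
  -- accepted.
  obtain ⟨h, hh, hspec⟩ := UniformlyComputable.search (o := o)
    (P := fun _ a => !decide (∃ x, hit (a.1, x) = true) || hit a)
    (UniformlyComputable.primrec_comp (f := fun y : Bool × Bool => !y.1 || y.2)
      (Primrec.or.comp (Primrec.not.comp Primrec.fst) Primrec.snd)
      ((hdec.comp_primrec Primrec.fst).pair (UniformlyComputable.of_primrec o hhit)))
    fun i a => by
      by_cases hx : ∃ x, hit (a, x) = true
      · obtain ⟨x, hx⟩ := hx
        exact ⟨x, by simp [hx]⟩
      · exact ⟨0, by simp [hx]⟩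
  have hstep := UniformlyComputable.primrec_comp hext
    ((UniformlyComputable.of_primrec o Primrec.id).pair hh)
  let step : ι → ℕ × List ℕ × List ℕ → List ℕ := fun i a =>
    extend a.2.2 a.2.1 (0 :: (Denumerable.ofNat (List ℕ × ℕ) (h i a)).1)
  have hseg : UniformlyComputable o fun i t => initSeg (p i) t :=
    (UniformlyComputable.initSeg_oracle p).trans UniformlyComputable.right_of_interleave
  let σ : ι → ℕ → List ℕ := fun i n => n.rec [] fun n b => step i (n, b, initSeg (p i) n)
  have hσ : UniformlyComputable o σ := by
    have hrec := UniformlyComputable.nat_rec (o := o) (f := fun _ (_ : Unit) => ([] : List ℕ))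
      (h := fun i (x : Unit × ℕ × List ℕ) => step i (x.2.1, x.2.2, initSeg (p i) x.2.1))
      (UniformlyComputable.of_primrec o (Primrec.const []))
      (UniformlyComputable.comp hstep ((UniformlyComputable.of_primrec o
        (Primrec.fst.comp Primrec.snd)).pair ((UniformlyComputable.of_primrec o
          (Primrec.snd.comp Primrec.snd)).pair
            (hseg.comp_primrec (Primrec.fst.comp Primrec.snd)))))
    exact hrec.comp_primrec (Primrec.pair (Primrec.const ()) Primrec.id)
  choose q hlim hinit hext' using fun i => exists_generic (p := p i) (σ := σ i) (fun n => rfl)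
  refine ⟨q, hlim, ?_⟩
  convert UniformlyComputable.primrec_comp (f := fun b : Bool => Encodable.encode b)
    Primrec.encode (hdec.comp ((UniformlyComputable.of_primrec o Primrec.id).pair
      (hσ.pair hseg))) using 3 with i n
  -- If program `n` halts on `q i`, it halts on a long initial segment, which is itself an
  -- admissible extension of stage `n`. Conversely, stage `n` adopts a successful extension whenever
  -- there is one, and the result is an initial segment of `q i`.
  have key : ((Prog.ofNatProg n).eval (q i) 0).Dom ↔
      ∃ x, hit ((n, σ i n, initSeg (p i) n), x) = true := by
    refine ⟨fun hd => ?_, fun hx => ?_⟩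
    · obtain ⟨s₀, hs₀⟩ := Prog.exists_evalBounded (Part.get_mem hd)
      obtain ⟨u, hu⟩ := hext' i n (max s₀ ((σ i n).length + 1)) (by omega)
      refine ⟨Encodable.encode (u, max s₀ ((σ i n).length + 1)), ?_⟩
      simp only [hit, Denumerable.ofNat_encode]
      rw [← hu, hs₀ _ (le_max_left _ _) _ fun _ _ => rfl]
      rfl
    · have hs := hspec i (n, σ i n, initSeg (p i) n)
      simp only [hx, decide_true, Bool.not_true, Bool.false_or] at hs
      obtain ⟨v, hv⟩ := Option.isSome_iff_exists.1 hs
      change Prog.evalBounded _ n (σ i (n + 1)) 0 = some v at hv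
      rw [hinit i (n + 1)] at hv
      exact Part.dom_iff_mem.2 ⟨v, Prog.eval_of_evalBounded hv⟩
  exact jump_eq_encode (key.trans decide_eq_true_iff.symm)

/-! ### Machines with a two-way output tape -/

theorem UniformlyComputable.outputTape {ι : Type*} {o e : ι → Baire}
    (he : UniformlyComputable o e) :
    UniformlyComputable o fun i (x : ℕ × ℕ) => RepSpaces.outputTape (e i) x.2 x.1 := by
  have hpred : Primrec fun y : ℕ × ℕ × ℕ × Option ℕ => (y.1 - 1).unpair :=
    Primrec.unpair.comp (Primrec.nat_sub.comp Primrec.fst (Primrec.const 1))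
  have hstep := primrec_comp (o := o)
    (f := fun y : ℕ × ℕ × ℕ × Option ℕ =>
      if y.1 ≠ 0 ∧ (y.1 - 1).unpair.1 = y.2.1 then some (y.1 - 1).unpair.2 else y.2.2.2)
    (Primrec.ite
      (((Primrec.eq.comp Primrec.fst (Primrec.const 0)).not).and
        (Primrec.eq.comp (Primrec.fst.comp hpred) (Primrec.fst.comp Primrec.snd)))
      (Primrec.option_some.comp (Primrec.snd.comp hpred))
      (Primrec.snd.comp (Primrec.snd.comp Primrec.snd)))
    ((he.comp_primrec (Primrec.fst.comp (Primrec.snd (α := ℕ) (β := ℕ × Option ℕ)))).pair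
      (of_primrec o Primrec.id))
  convert nat_rec (of_primrec o (Primrec.const (α := ℕ) (none : Option ℕ))) hstep using 3 with i x
  obtain ⟨k, t⟩ := x
  induction t with
  | zero => rfl
  | succ t ih =>
    simp only [RepSpaces.outputTape, id] at ih ⊢
    rw [ih]

/-- The machine that runs through the given sequence and writes its entries to the columns. -/
theorem outputTape_eventually_eq {p q e : Baire} (hpq : q ∈ limMap p)
    (he : ∀ t, e t = Nat.pair t.unpair.2 (p t) + 1) (n : ℕ) :
    ∃ t₀, ∀ t ≥ t₀, outputTape e t n = some (q n) := by
  obtain ⟨s₀, hs₀⟩ := mem_limMap_iff.1 hpq n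
  refine ⟨Nat.pair s₀ n + 1, fun t ht => ?_⟩
  induction t, ht using Nat.le_induction with
  | base => simp [outputTape, he, hs₀]
  | succ t ht ih =>
    rw [outputTape, ih, he]
    by_cases hn : t.unpair.2 = n
    · have hs : s₀ ≤ t.unpair.1 := by
        by_contra hlt
        have h := Nat.pair_lt_pair_left n (not_le.1 hlt)
        rw [← hn, Nat.pair_unpair, hn] at h
        omega
      have hpt : p t = q n := by rw [← hs₀ _ hs, ← hn, Nat.pair_unpair]
      simp [hn, hpt]
    · simp [hn]

/-! ### Problems in terms of uniform computability -/

theorem UniformlyComputable.exists_isComputable {ι : Type*} {o g : ι → Baire}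
    (hg : UniformlyComputable o g) :
    ∃ F : Baire → Part Baire, IsComputable F ∧ ∀ i, g i ∈ F (o i) := by
  obtain ⟨c, hc⟩ := hg
  refine ⟨fun p => ⟨∀ n, (c.eval p n).Dom, fun h n => (c.eval p n).get (h n)⟩, ⟨c, ?_⟩, fun i => ?_⟩
  · rintro p q ⟨h, rfl⟩ n
    exact Part.get_mem (h n)
  · exact ⟨fun n => Part.dom_iff_mem.2 ⟨_, hc i n⟩,
      funext fun n => Part.get_eq_of_mem (hc i n) _⟩

section Problems

variable {X : Type u} {Y : Type v} {δ : Representation X} {ε : Representation Y} {f : X → Set Y}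

theorem mem_L {p q : Baire} : q ∈ L p ↔ jump q ∈ limMap p := by
  simp only [L, Part.mem_bind_iff, mem_inverse J_inverse_unique, J, Set.mem_singleton_iff,
    exists_eq_right]

namespace Representation

theorem mem_limJump {p : Baire} {x : X} :
    x ∈ δ.limJump.map p ↔ ∃ q ∈ limMap p, x ∈ δ.map q :=
  Part.mem_bind_iff

theorem mem_lowJump {p : Baire} {x : X} :
    x ∈ δ.lowJump.map p ↔ ∃ q, jump q ∈ limMap p ∧ x ∈ δ.map q := by
  simp only [lowJump, upper, Part.mem_bind_iff, mem_L]

theorem mem_subJ {p : Baire} {x : X} :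
    x ∈ δ.subJ.map p ↔ ∃ q, p = jump q ∧ x ∈ δ.map q := by
  simp only [subJ, lower, upper, Part.mem_bind_iff, mem_inverse J_inverse_unique, J,
    Set.mem_singleton_iff]

theorem mem_subH {p : Baire} {x : X} :
    x ∈ δ.subH.map p ↔ ∃ r, (∃ q, r ∈ limMap q ∧ p = jump q) ∧ x ∈ δ.map r := by
  simp only [subH, lower, upper, Part.mem_bind_iff, mem_inverse H_inverse_unique, H,
    Set.mem_ofPred_eq]

end Representation

/-- The pairs `(o i, x i)` are the names of the points in the domain of `f`, together with these
points. -/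
def Names {ι : Type*} (δ : Representation X) (f : X → Set Y) (o : ι → Baire) (x : ι → X) : Prop :=
  ∀ p a, a ∈ δ.map p ∧ (f a).Nonempty ↔ ∃ i, o i = p ∧ x i = a

/-- The points `g i` are names of solutions of the instances `x i` of the problem `f`. -/
def Solves {ι : Type*} (ε : Representation Y) (f : X → Set Y) (x : ι → X) (g : ι → Baire) : Prop :=
  ∀ i, ∃ y ∈ ε.map (g i), y ∈ f (x i)

/-- The names of the points in the domain of a problem, together with these points. -/
abbrev NamedInstance (δ : Representation X) (f : X → Set Y) : Type u :=
  {z : Baire × X // z.2 ∈ δ.map z.1 ∧ (f z.2).Nonempty}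

theorem names_namedInstance (δ : Representation X) (f : X → Set Y) :
    Names δ f (fun z : NamedInstance δ f => z.1.1) (fun z => z.1.2) :=
  fun p a => ⟨fun h => ⟨⟨(p, a), h⟩, rfl, rfl⟩, by rintro ⟨z, rfl, rfl⟩; exact z.2⟩

/-! ### Names in the derived representations -/

namespace Names

variable {ι : Type*} {o : ι → Baire} {x : ι → X}

theorem subJ (h : Names δ f o x) : Names δ.subJ f (fun i => jump (o i)) x := by
  intro p a
  simp only [Representation.mem_subJ]
  constructor
  · rintro ⟨⟨q, rfl, hq⟩, hf⟩
    obtain ⟨i, rfl, hi⟩ := (h q a).1 ⟨hq, hf⟩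
    exact ⟨i, rfl, hi⟩
  · rintro ⟨i, rfl, hi⟩
    obtain ⟨hq, hf⟩ := (h _ a).2 ⟨i, rfl, hi⟩
    exact ⟨⟨_, rfl, hq⟩, hf⟩

theorem limJump (h : Names δ f o x) :
    Names δ.limJump f (fun z : {z : Baire × ι // o z.2 ∈ limMap z.1} => z.1.1)
      (fun z => x z.1.2) := by
  intro p a
  simp only [Representation.mem_limJump]
  constructor
  · rintro ⟨⟨q, hq, ha⟩, hf⟩
    obtain ⟨i, rfl, hi⟩ := (h q a).1 ⟨ha, hf⟩
    exact ⟨⟨(p, i), hq⟩, rfl, hi⟩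
  · rintro ⟨z, rfl, hi⟩
    obtain ⟨ha, hf⟩ := (h _ a).2 ⟨z.1.2, rfl, hi⟩
    exact ⟨⟨_, z.2, ha⟩, hf⟩

theorem lowJump (h : Names δ f o x) :
    Names δ.lowJump f (fun z : {z : Baire × ι // jump (o z.2) ∈ limMap z.1} => z.1.1)
      (fun z => x z.1.2) := by
  intro p a
  simp only [Representation.mem_lowJump]
  constructor
  · rintro ⟨⟨q, hq, ha⟩, hf⟩
    obtain ⟨i, rfl, hi⟩ := (h q a).1 ⟨ha, hf⟩
    exact ⟨⟨(p, i), hq⟩, rfl, hi⟩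
  · rintro ⟨z, rfl, hi⟩
    obtain ⟨ha, hf⟩ := (h _ a).2 ⟨z.1.2, rfl, hi⟩
    exact ⟨⟨_, z.2, ha⟩, hf⟩

theorem subH (h : Names δ f o x) :
    Names δ.subH f (fun z : {z : Baire × ι // o z.2 ∈ limMap z.1} => jump z.1.1)
      (fun z => x z.1.2) := by
  intro p a
  simp only [Representation.mem_subH]
  constructor
  · rintro ⟨⟨r, ⟨q, hq, rfl⟩, ha⟩, hf⟩
    obtain ⟨i, rfl, hi⟩ := (h r a).1 ⟨ha, hf⟩
    exact ⟨⟨(q, i), hq⟩, rfl, hi⟩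
  · rintro ⟨z, rfl, hi⟩
    obtain ⟨ha, hf⟩ := (h _ a).2 ⟨z.1.2, rfl, hi⟩
    exact ⟨⟨_, ⟨_, z.2, rfl⟩, ha⟩, hf⟩

/-- Forward, `g` consists of the values of a realizer. Backward, the program for `g` defines a
realizer on the inputs where it is total. Thus all further arguments can work with families instead
of partial functions. -/
theorem computable_iff (h : Names δ f o x) :
    ComputableProblem δ ε f ↔ ∃ g, UniformlyComputable o g ∧ Solves ε f x g := by
  constructor
  · rintro ⟨F, ⟨c, hc⟩, hF⟩
    choose g hg hs using fun i =>
      hF (o i) (x i) ((h _ _).2 ⟨i, rfl, rfl⟩).1 ((h _ _).2 ⟨i, rfl, rfl⟩).2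
    exact ⟨g, ⟨c, fun i n => hc _ _ (hg i) n⟩, hs⟩
  · rintro ⟨g, hg, hs⟩
    obtain ⟨F, hF, hgF⟩ := hg.exists_isComputable
    refine ⟨F, hF, fun p a ha hf => ?_⟩
    obtain ⟨i, rfl, rfl⟩ := (h p a).1 ⟨ha, hf⟩
    exact ⟨g i, hgF i, hs i⟩

theorem computableRel_iff (h : Names δ f o x) (q : Baire) :
    ComputableRelProblem q δ ε f ↔
      ∃ g, UniformlyComputable (fun i => interleave q (o i)) g ∧ Solves ε f x g := by
  constructor
  · rintro ⟨F, ⟨G, ⟨c, hc⟩, hG⟩, hF⟩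
    choose g hg hs using fun i =>
      hF (o i) (x i) ((h _ _).2 ⟨i, rfl, rfl⟩).1 ((h _ _).2 ⟨i, rfl, rfl⟩).2
    exact ⟨g, ⟨c, fun i n => hc _ _ (hG _ _ (hg i)) n⟩, hs⟩
  · rintro ⟨g, hg, hs⟩
    obtain ⟨F, hF, hgF⟩ := hg.exists_isComputable
    refine ⟨fun p => F (interleave q p), ⟨F, hF, fun _ _ hr => hr⟩, fun p a ha hf => ?_⟩
    obtain ⟨i, rfl, rfl⟩ := (h p a).1 ⟨ha, hf⟩
    exact ⟨g i, hgF i, hs i⟩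

end Names

section Solves

variable {ι : Type*} {x : ι → X} {g : ι → Baire}

theorem Solves.reindex {κ : Type*} (h : Solves ε f x g) (r : κ → ι) :
    Solves ε f (x ∘ r) (g ∘ r) :=
  fun k => h (r k)

theorem solves_limJump_iff :
    Solves ε.limJump f x g ↔ ∃ r : ι → Baire, (∀ i, r i ∈ limMap (g i)) ∧ Solves ε f x r := by
  simp only [Solves, Representation.mem_limJump]
  constructor
  · intro h
    choose y hy hf using h
    choose r hr hy using hy
    exact ⟨r, hr, fun i => ⟨y i, hy i, hf i⟩⟩
  · rintro ⟨r, hr, h⟩ i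
    obtain ⟨y, hy, hf⟩ := h i
    exact ⟨y, ⟨r i, hr i, hy⟩, hf⟩

theorem solves_lowJump_iff :
    Solves ε.lowJump f x g ↔
      ∃ r : ι → Baire, (∀ i, jump (r i) ∈ limMap (g i)) ∧ Solves ε f x r := by
  simp only [Solves, Representation.mem_lowJump]
  constructor
  · intro h
    choose y hy hf using h
    choose r hr hy using hy
    exact ⟨r, hr, fun i => ⟨y i, hy i, hf i⟩⟩
  · rintro ⟨r, hr, h⟩ i
    obtain ⟨y, hy, hf⟩ := h i
    exact ⟨y, ⟨r i, hr i, hy⟩, hf⟩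

theorem solves_subJ_iff :
    Solves ε.subJ f x g ↔ ∃ r : ι → Baire, g = (fun i => jump (r i)) ∧ Solves ε f x r := by
  simp only [Solves, Representation.mem_subJ]
  constructor
  · intro h
    choose y hy hf using h
    choose r hr hy using hy
    exact ⟨r, funext hr, fun i => ⟨y i, hy i, hf i⟩⟩
  · rintro ⟨r, rfl, h⟩ i
    obtain ⟨y, hy, hf⟩ := h i
    exact ⟨y, ⟨r i, rfl, hy⟩, hf⟩

theorem solves_subH_iff :
    Solves ε.subH f x g ↔ ∃ r q : ι → Baire,
      (∀ i, r i ∈ limMap (q i)) ∧ g = (fun i => jump (q i)) ∧ Solves ε f x r := by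
  simp only [Solves, Representation.mem_subH]
  constructor
  · intro h
    choose y hy hf using h
    choose r hr hy using hy
    choose q hq hr using hr
    exact ⟨r, q, hq, funext hr, fun i => ⟨y i, hy i, hf i⟩⟩
  · rintro ⟨r, q, hq, rfl, h⟩ i
    obtain ⟨y, hy, hf⟩ := h i
    exact ⟨y, ⟨r i, ⟨q i, hq i, rfl⟩, hy⟩, hf⟩

end Solves

/-! ### The equivalences -/

variable (δ ε f)

/-- The successive contents of a revisable tape form a sequence converging to the output.
Conversely, a machine can write the entries of a convergent sequence row after row into the cells of
the output. -/
theorem limitComputable_iff_limJump :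
    LimitComputableProblem δ ε f ↔ ComputableProblem δ ε.limJump f := by
  constructor
  · rintro ⟨F, ⟨c, hc⟩, hF⟩
    refine (names_namedInstance δ f).computable_iff.2 ?_
    choose r hr hs using fun z : NamedInstance δ f => hF z.1.1 z.1.2 z.2.1 z.2.2
    choose e he hlim using fun z => hc z.1.1 (r z) (hr z)
    -- Row `t` is the tape after `t` steps, with blank cells read as `0`; each cell is blank only
    -- finitely long.
    have hg := UniformlyComputable.primrec_comp
      (Primrec.option_getD.comp Primrec.id (Primrec.const 0))
      ((UniformlyComputable.outputTape (o := fun z : NamedInstance δ f => z.1.1)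
        ⟨c, fun z n => he z n⟩).comp_primrec
        (Primrec.pair (Primrec.snd.comp Primrec.unpair) (Primrec.fst.comp Primrec.unpair)))
    refine ⟨_, hg, solves_limJump_iff.2 ⟨r, fun z => mem_limMap_iff.2 fun k => ?_, hs⟩⟩
    obtain ⟨t₀, ht₀⟩ := hlim z k
    refine ⟨t₀, fun t ht => ?_⟩
    simp only [Nat.unpair_pair, id, ht₀ t ht, Option.getD_some]
  · rintro ⟨G, ⟨c, hc⟩, hG⟩
    have hG' : UniformlyComputable (fun z : {z : Baire × Baire // z.2 ∈ G z.1} => z.1.1)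
        fun z => z.1.2 := ⟨c, fun z n => hc _ _ z.2 n⟩
    obtain ⟨d, hd⟩ := UniformlyComputable.primrec_comp
      (f := fun y : ℕ × ℕ => Nat.pair y.1.unpair.2 y.2 + 1)
      (Primrec.succ.comp (Primrec₂.natPair.comp
        (Primrec.snd.comp (Primrec.unpair.comp Primrec.fst)) Primrec.snd))
      ((UniformlyComputable.of_primrec _ Primrec.id).pair hG')
    refine ⟨fun p => (G p).bind limMap, ⟨d, fun p q hq => ?_⟩, fun p a ha hf => ?_⟩
    · obtain ⟨r, hr, hq⟩ := Part.mem_bind_iff.1 hq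
      exact ⟨_, hd ⟨(p, r), hr⟩, outputTape_eventually_eq hq fun t => rfl⟩
    · obtain ⟨r, hr, y, hy, hfy⟩ := hG p a ha hf
      obtain ⟨q, hq, hy⟩ := Representation.mem_limJump.1 hy
      exact ⟨q, Part.mem_bind hr hq, y, hy, hfy⟩

/-- This is the limit lemma: the names for `δ.subJ` are the jumps of the names for `δ`, and what a
jump computes is what is a limit of computable sequences. -/
theorem computable_limJump_iff_subJ :
    ComputableProblem δ ε.limJump f ↔ ComputableProblem δ.subJ ε f := by
  have h := names_namedInstance δ f
  rw [h.computable_iff, h.subJ.computable_iff]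
  constructor
  · rintro ⟨g, hg, hs⟩
    obtain ⟨r, hr, hs⟩ := solves_limJump_iff.1 hs
    exact ⟨r, hg.of_limit hr, hs⟩
  · rintro ⟨r, hr, hs⟩
    obtain ⟨g, hg, hlim⟩ := exists_limit_of_jump hr
    exact ⟨g, hg, solves_limJump_iff.2 ⟨r, hlim, hs⟩⟩

theorem low_iff_lowJump : LowProblem δ ε f ↔ ComputableProblem δ ε.lowJump f := by
  constructor
  · rintro ⟨F, ⟨G, hG, rfl⟩, hF⟩
    refine ⟨G, hG, fun p a ha hf => ?_⟩
    obtain ⟨q, hq, y, hy, hfy⟩ := hF p a ha hf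
    obtain ⟨r, hr, hq⟩ := Part.mem_bind_iff.1 hq
    exact ⟨r, hr, y, Part.mem_bind hq hy, hfy⟩
  · rintro ⟨G, hG, hF⟩
    refine ⟨fun p => (G p).bind L, ⟨G, hG, rfl⟩, fun p a ha hf => ?_⟩
    obtain ⟨r, hr, y, hy, hfy⟩ := hF p a ha hf
    obtain ⟨q, hq, hy⟩ := Part.mem_bind_iff.1 hy
    exact ⟨q, Part.mem_bind hr hq, y, hy, hfy⟩

theorem low_tfae : List.TFAE [
    LowProblem δ ε f,
    ComputableProblem δ ε.lowJump f,
    ComputableProblem δ.lowJump ε.lowJump f,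
    ComputableProblem δ.subJ ε.subJ f,
    ComputableRelProblem haltingProblem δ.subJ ε.subJ f] := by
  have h := names_namedInstance δ f
  tfae_have 1 ↔ 2 := low_iff_lowJump δ ε f
  -- The solution supplied is a sequence converging to `jump (r i)`, so the jump of the input name
  -- computes `jump (r i)`.
  tfae_have 2 → 4 := by
    rw [h.computable_iff, h.subJ.computable_iff]
    rintro ⟨g, hg, hs⟩
    obtain ⟨r, hr, hs⟩ := solves_lowJump_iff.1 hs
    exact ⟨_, hg.of_limit hr, solves_subJ_iff.2 ⟨r, rfl, hs⟩⟩
  -- The input is now a sequence with limit `jump (o i)`; the computation of `jump (r i)` from this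
  -- limit is carried out along the sequence.
  tfae_have 4 → 3 := by
    rw [h.lowJump.computable_iff, h.subJ.computable_iff]
    rintro ⟨g, hg, hs⟩
    obtain ⟨r, rfl, hr⟩ := solves_subJ_iff.1 hs
    obtain ⟨k, hk, hlim⟩ := (hg.reindex fun z : {z : Baire × NamedInstance δ f //
      jump z.2.1.1 ∈ limMap z.1} => z.1.2).exists_limit (p := fun z => z.1.1) fun z => z.2
    exact ⟨k, hk, solves_lowJump_iff.2 ⟨_, hlim, hr.reindex _⟩⟩
  -- A sequence converging to the jump of the input name is computable from that name, so it can be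
  -- fed to the given program.
  tfae_have 3 → 2 := by
    rw [h.lowJump.computable_iff, h.computable_iff]
    rintro ⟨g, hg, hs⟩
    obtain ⟨a, ha, hlim⟩ := exists_limit_jump fun z : NamedInstance δ f => z.1.1
    exact ⟨_, (hg.reindex fun z : NamedInstance δ f => ⟨(a z, z), hlim z⟩).trans ha, hs.reindex _⟩
  tfae_have 4 ↔ 5 := by
    rw [h.subJ.computable_iff, h.subJ.computableRel_iff]
    exact ⟨fun ⟨g, hg, hs⟩ => ⟨g, hg.trans .right_of_interleave, hs⟩,
      fun ⟨g, hg, hs⟩ => ⟨g, hg.trans (UniformlyComputable.interleave_iff.2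
        ⟨uniformlyComputable_haltingProblem _, .oracle _⟩), hs⟩⟩
  tfae_finish

theorem computableRel_haltingProblem_tfae : List.TFAE [
    ComputableRelProblem haltingProblem δ ε f,
    ComputableProblem δ.subH ε f,
    ComputableProblem δ.subH ε.subH f,
    ComputableProblem δ.limJump ε.limJump f,
    LowProblem δ.limJump ε.limJump f] := by
  have h := names_namedInstance δ f
  obtain ⟨q, hq, hjump⟩ := exists_low_limit fun z : NamedInstance δ f => z.1.1
  -- The jump of any sequence computes the halting problem and the limit of the sequence.
  have hoi : UniformlyComputable
      (fun z : {z : Baire × NamedInstance δ f // z.2.1.1 ∈ limMap z.1} => jump z.1.1)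
      fun z => interleave haltingProblem z.1.2.1.1 :=
    UniformlyComputable.interleave_iff.2 ⟨uniformlyComputable_haltingProblem _,
      (UniformlyComputable.oracle _).of_limit fun z => z.2⟩
  -- The solution `g` is computable from the given jump. A low limit construction for `g` then
  -- yields the jump of a sequence converging to `g`.
  tfae_have 1 → 3 := by
    rw [h.computableRel_iff, h.subH.computable_iff]
    rintro ⟨g, hg, hs⟩
    have hg' := (hg.reindex fun z : {z : Baire × NamedInstance δ f // z.2.1.1 ∈ limMap z.1} =>
      z.1.2).trans hoi
    obtain ⟨r, hr, hjr⟩ := exists_low_limit fun z :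
      {z : Baire × NamedInstance δ f // z.2.1.1 ∈ limMap z.1} => g z.1.2
    refine ⟨_, hjr.trans (UniformlyComputable.interleave_iff.2
      ⟨uniformlyComputable_haltingProblem _, hg'⟩),
      solves_subH_iff.2 ⟨_, r, hr, rfl, hs.reindex _⟩⟩
  tfae_have 3 → 2 := by
    rw [h.subH.computable_iff, h.subH.computable_iff]
    rintro ⟨g, hg, hs⟩
    obtain ⟨r, s, hr, rfl, hs'⟩ := solves_subH_iff.1 hs
    exact ⟨r, ((UniformlyComputable.oracle s).of_limit hr).trans hg, hs'⟩
  -- With `0'` and a name available, the jump of the special sequence `q z` is computable, and it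
  -- serves as input of the program for `δ.subH`.
  tfae_have 2 → 1 := by
    rw [h.computableRel_iff, h.subH.computable_iff]
    rintro ⟨g, hg, hs⟩
    exact ⟨_, (hg.reindex fun z : NamedInstance δ f => ⟨(q z, z), hq z⟩).trans hjump, hs.reindex _⟩
  tfae_have 1 → 4 := by
    rw [h.computableRel_iff, computable_limJump_iff_subJ, h.limJump.subJ.computable_iff]
    rintro ⟨g, hg, hs⟩
    exact ⟨_, (hg.reindex fun z : {z : Baire × NamedInstance δ f // z.2.1.1 ∈ limMap z.1} =>
      z.1.2).trans hoi, hs.reindex _⟩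
  -- Every computable problem is low: the jump of the output is a limit computable from the output.
  tfae_have 4 → 5 := by
    rw [low_iff_lowJump, h.limJump.computable_iff, h.limJump.computable_iff]
    rintro ⟨g, hg, hs⟩
    obtain ⟨a, ha, hlim⟩ := exists_limit_jump g
    exact ⟨a, ha.trans hg, solves_lowJump_iff.2 ⟨g, hlim, hs⟩⟩
  -- On the input `q z`, its jump computes `jump (s i)` as a limit, and this computes the solution
  -- as the limit of `s i`. That jump is computable from `0'` and the original name.
  tfae_have 5 → 1 := by
    rw [low_iff_lowJump, h.limJump.computable_iff, h.computableRel_iff]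
    rintro ⟨g, hg, hs⟩
    obtain ⟨s, hlow, hs⟩ := solves_lowJump_iff.1 hs
    obtain ⟨r, hlim, hs⟩ := solves_limJump_iff.1 hs
    have hr := ((UniformlyComputable.oracle s).of_limit hlim).trans (hg.of_limit hlow)
    exact ⟨_, (hr.reindex fun z : NamedInstance δ f => ⟨(q z, z), hq z⟩).trans hjump, hs.reindex _⟩
  tfae_finish

end Problems

end RepSpaces

theorem corollary4p19 {X : Type u} {Y : Type v}
    (δX : Representation X) (δY : Representation Y) (f : X → Set Y)
    {U : Type w} {A B : Set U} (hAB : A ⊆ B) (δA : Representation A) (δB : Representation B) :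
    -- limit computability
    List.TFAE [
      LimitComputableProblem δX δY f,
      ComputableProblem δX δY.limJump f,
      ComputableProblem δX.subJ δY f] ∧
    -- low computability
    List.TFAE [
      LowProblem δX δY f,
      ComputableProblem δX δY.lowJump f,
      ComputableProblem δX.lowJump δY.lowJump f,
      ComputableProblem δX.subJ δY.subJ f,
      ComputableRelProblem haltingProblem δX.subJ δY.subJ f] ∧
    -- computability relative to the halting problem
    List.TFAE [
      ComputableRelProblem haltingProblem δX δY f,
      ComputableProblem δX.subH δY f,
      ComputableProblem δX.subH δY.subH f,
      ComputableProblem δX.limJump δY.limJump f,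
      LowProblem δX.limJump δY.limJump f] ∧
    -- reducibility of representations
    (Reducible hAB δA.subJ δB ↔ Reducible hAB δA δB.limJump) ∧
    -- the Galois connection in the preorder of all representations of a fixed set
    GaloisConnection
      (Representation.subJ : Representation X → Representation X) Representation.limJump := by
  -- Reducibility is by definition computability of the inclusion, so the adjunction for
  -- representations is the equivalence for problems applied to the inclusion or the identity.
  refine ⟨?_, low_tfae δX δY f, computableRel_haltingProblem_tfae δX δY f,
    (computable_limJump_iff_subJ δA δB _).symm,
    fun δ ε => (computable_limJump_iff_subJ δ ε _).symm⟩
  tfae_have 1 ↔ 2 := limitComputable_iff_limJump δX δY f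
  tfae_have 2 ↔ 3 := computable_limJump_iff_subJ δX δY f
  tfae_finish
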